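/- **Model.** Let $d,n\ge 1$, write $\langle X,B\rangle=\operatorname{trace}(XB)$ for $X,B\in\mathbb R^{d\times d}$, and let $S^d_{1,+}$ be the set of symmetric positive semidefinite $B\in\mathbb R^{d\times d}$ with Frobenius norm $\|B\|_F=1$. Let $Y=f^\star(\langle X,B^\star\rangle)+\varepsilon$, where $X$ is a random $d\times d$ matrix, $B^\star\in S^d_{1,+}$, $f^\star:\mathbb R\to\mathbb R$ is measurable and $\mathbb E[\varepsilon\mid X]=0$. Let $R(B,f)=\mathbb E[(Y-f(\langle X,B\rangle))^2]$ and, for $n$ independent copies $(X_i,Y_i)$ of $(X,Y)$, $r_n(B,f)=\frac1n\sum_{i=1}^n(Y_i-f(\langle X_i,B\rangle))^2$. Assume, for constants $\sigma,L,A>0$ and $C\ge1$: (N) $\mathbb E[|\varepsilon|^m\mid X]\le\frac{m!}{2}\sigma^2L^{m-2}$ almost surely for all integers $m\ge2$; (B) almost surely all entries of $X$ have absolute value at most $1$, and $|f^\star|\le C$ on $[-1,1]$; (D) $\langle X,B^\star\rangle$ has a probability density on $[-1,1]$ bounded above by $A$. **Prior.** Let $\varphi_1=1$, $\varphi_{2j}(t)=\cos(\pi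 jt)$, $\varphi_{2j+1}(t)=\sin(\pi jt)$ for $j\ge1$, $t\in\mathbb R$. Let $\mu$ be the law of $V\operatorname{diag}(\gamma_1^{1/2},\dots,\gamma_d^{1/2})V^\top$, where $V$ is a Haar distributed orthogonal matrix and, independently, $\gamma\sim\mathrm{Dir}(\alpha_1,\dots,\alpha_d)$ with $\sum_i\alpha_i=1$ and $\alpha_i\ge D_1/d$ for a constant $D_1>0$ (for instance $\alpha_i=1/d$, $D_1=1$). Let $\nu_M$ be the law of $\sum_{j=1}^M\beta_j\varphi_j$ with $\beta$ uniform on $\{\beta\in\mathbb R^M:\sum_{j=1}^M j|\beta_j|\le C+1,\ \beta_M\ne0\}$, let $\nu$ be the probability measure proportional to $\sum_{M=1}^n10^{-M}\nu_M$, and let $\pi=\mu\otimes\nu$. **Estimator.** Let $w=64(C+1)\max[L,C+1]$, $C_1=8[(C+1)^2+\sigma^2]$, $\lambda=n/(w+2C_1)$, and draw $(\hat B_\lambda,\hat f_\lambda)$ from the Gibbs posterior $\hat\rho_\lambda$, the probability measure with $\frac{d\hat\rho_\lambda}{d\pi}(B,f)=\exp[-\lambda r_n(B,f)]\big/\int\exp[-\lambda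 r_n]\,d\pi$. **Claim.** There is a constant $\Xi'>0$ depending only on $L,C,\sigma,A$ and $D_1$ (so only on $L,C,\sigma,A$ when $\alpha_i=1/d$) such that the following holds for all $d,n$ and all models and priors as above. If, for some real $k\ge2$, $f^\star$ belongs to the Sobolev ellipsoid $$\mathcal W\Big(k,\tfrac{6C^2}{\pi^2}\Big)=\Big\{f\in L_2([-1,1]):\ f=\sum_{j\ge1}\beta_j\varphi_j,\ \sum_{j\ge1}j^{2k}\beta_j^2\le\tfrac{6C^2}{\pi^2}\Big\},$$ then for every $\delta\in(0,1)$, with probability at least $1-\delta$ (over the sample and the draw from $\hat\rho_\lambda$), $$R(\hat B_\lambda,\hat f_\lambda)-R(B^\star,f^\star)\le\Xi'\left\{\Big(\frac{\log(Cn)}{n}\Big)^{\frac{2k}{2k+1}}+\frac{\operatorname{rank}(B^\star)\,d\log(16n)+d\log d\,\log(2ne)}{n}+\frac{\log(2/\delta)}{n}\right\}.$$ Neither $\lambda$, the estimator nor $\Xi'$ depends on $k$ (the estimator is adaptive). -/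

import Mathlib

open MeasureTheory ProbabilityTheory Filter Topology
open scoped ENNReal Nat

noncomputable section

namespace LowRankSIM

/-! ### Measurable structures -/

/-- Square matrices carry the product (equivalently, the Borel) sigma-algebra. -/
instance instMeasurableSpaceMatrix (d : ℕ) :
    MeasurableSpace (Matrix (Fin d) (Fin d) ℝ) :=
  inferInstanceAs (MeasurableSpace (Fin d → Fin d → ℝ))

instance instBorelSpaceMatrix (d : ℕ) : BorelSpace (Matrix (Fin d) (Fin d) ℝ) :=
  inferInstanceAs (BorelSpace (Fin d → Fin d → ℝ))

/-- Link functions are continuous functions on the real line, with the Borel sigma-algebra of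
locally uniform convergence. -/
instance instMeasurableSpaceLink : MeasurableSpace C(ℝ, ℝ) := borel _

instance instBorelSpaceLink : BorelSpace C(ℝ, ℝ) := ⟨rfl⟩

instance instCompactSpaceOrthogonal (d : ℕ) :
    CompactSpace (Matrix.orthogonalGroup (Fin d) ℝ) := by
  have hcl : IsClosed ((Matrix.orthogonalGroup (Fin d) ℝ : Set (Matrix (Fin d) (Fin d) ℝ))) := by
    have h : (Matrix.orthogonalGroup (Fin d) ℝ : Set (Matrix (Fin d) (Fin d) ℝ))
        = {A | A * star A = 1} := by
      ext A
      exact Matrix.mem_orthogonalGroup_iff (Fin d) ℝ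
    rw [h]
    exact isClosed_eq (by fun_prop) continuous_const
  have hK : IsCompact (Set.univ.pi fun _ : Fin d => Set.univ.pi fun _ : Fin d =>
      Set.Icc (-1 : ℝ) 1) :=
    isCompact_univ_pi fun _ => isCompact_univ_pi fun _ => isCompact_Icc
  refine isCompact_iff_compactSpace.mp (IsCompact.of_isClosed_subset hK hcl ?_)
  intro A hA i _ j _
  have h := entry_norm_bound_of_unitary (𝕜 := ℝ) hA i j
  rw [Real.norm_eq_abs] at h
  exact abs_le.mp h

/-! ### The model and the risks -/

/-- `⟨X, B⟩ = trace (X B)`. -/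
def pairing {d : ℕ} (X B : Matrix (Fin d) (Fin d) ℝ) : ℝ := (X * B).trace

/-- The Frobenius norm. -/
def frobNorm {d : ℕ} (B : Matrix (Fin d) (Fin d) ℝ) : ℝ := √(∑ i, ∑ j, B i j ^ 2)

/-- The set of index matrices: symmetric positive semidefinite, with unit Frobenius norm. -/
def indexSet (d : ℕ) : Set (Matrix (Fin d) (Fin d) ℝ) :=
  {B | B.PosSemidef ∧ frobNorm B = 1}

/-- The expected risk `E (Y - f(⟨X, B⟩))²`. -/
def risk {Ω : Type*} [MeasurableSpace Ω] (μ : Measure Ω) {d : ℕ}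
    (X : Ω → Matrix (Fin d) (Fin d) ℝ) (Y : Ω → ℝ)
    (B : Matrix (Fin d) (Fin d) ℝ) (f : ℝ → ℝ) : ℝ :=
  ∫ ω, (Y ω - f (pairing (X ω) B)) ^ 2 ∂μ

/-- The empirical risk of a sample `D = ((X₁, Y₁), …, (Xₙ, Yₙ))`. -/
def empRisk {d n : ℕ} (D : Fin n → Matrix (Fin d) (Fin d) ℝ × ℝ)
    (B : Matrix (Fin d) (Fin d) ℝ) (f : ℝ → ℝ) : ℝ :=
  (1 / (n : ℝ)) * ∑ i, ((D i).2 - f (pairing (D i).1 B)) ^ 2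

/-- Sub-exponential noise: `E (|ε|ᵏ | X) ≤ k!/2 σ² Lᵏ⁻²` almost surely for every integer
`k ≥ 2` (the moments being finite). -/
def SubexpNoise {Ω : Type*} [MeasurableSpace Ω] (μ : Measure Ω) {d : ℕ}
    (X : Ω → Matrix (Fin d) (Fin d) ℝ) (ε : Ω → ℝ) (σ L : ℝ) : Prop :=
  ∀ k : ℕ, 2 ≤ k → Integrable (fun ω => |ε ω| ^ k) μ ∧
    μ[fun ω => |ε ω| ^ k | MeasurableSpace.comap X inferInstance]
      ≤ᵐ[μ] fun _ => (k ! : ℝ) / 2 * σ ^ 2 * L ^ (k - 2)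

/-- The real random variable `Z` has a density on `[-1, 1]` bounded above by `A`. -/
def HasBoundedDensity {Ω : Type*} [MeasurableSpace Ω] (μ : Measure Ω) (Z : Ω → ℝ) (A : ℝ) :
    Prop :=
  ∃ p : ℝ → ℝ≥0∞, Measurable p ∧ (∀ t, p t ≤ ENNReal.ofReal A) ∧
    μ.map Z = (volume.restrict (Set.Icc (-1 : ℝ) 1)).withDensity p

/-! ### The trigonometric dictionary and the Sobolev ellipsoid -/

/-- The non-normalized trigonometric system `φ₁ = 1`, `φ₂ⱼ(t) = cos (π j t)`,
`φ₂ⱼ₊₁(t) = sin (π j t)` for `j ≥ 1` (the index `0` is not used). -/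
def trig (j : ℕ) : C(ℝ, ℝ) :=
  if j = 1 then 1
  else if Even j then ⟨fun t => Real.cos (Real.pi * (j / 2 : ℕ) * t), by fun_prop⟩
  else ⟨fun t => Real.sin (Real.pi * (j / 2 : ℕ) * t), by fun_prop⟩

/-- `f` lies in the Sobolev ellipsoid `W(k, Q)`: `f ∈ L²([-1, 1])`, `f = ∑_{j ≥ 1} βⱼ φⱼ` in
`L²([-1, 1])` and `∑_{j ≥ 1} j²ᵏ βⱼ² ≤ Q`. The coefficient of `φⱼ₊₁` is `β j`. -/
def SobolevEllipsoid (k Q : ℝ) (f : ℝ → ℝ) : Prop :=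
  MemLp f 2 (volume.restrict (Set.Icc (-1 : ℝ) 1)) ∧
  ∃ β : ℕ → ℝ,
    Tendsto (fun N : ℕ => eLpNorm (fun t => f t - ∑ j ∈ Finset.range N, β j * trig (j + 1) t) 2
      (volume.restrict (Set.Icc (-1 : ℝ) 1))) atTop (𝓝 0) ∧
    Summable (fun j : ℕ => ((j : ℝ) + 1) ^ (2 * k) * β j ^ 2) ∧
    ∑' j : ℕ, ((j : ℝ) + 1) ^ (2 * k) * β j ^ 2 ≤ Q

/-! ### The prior -/

/-- The Dirichlet distribution with parameters `α₁, …, α_d`: the law of `G / ∑ⱼ Gⱼ` for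
independent `Gᵢ` with the gamma distribution of shape `αᵢ` and rate `1`. -/
def dirichlet {d : ℕ} (α : Fin d → ℝ) : Measure (Fin d → ℝ) :=
  (Measure.pi fun i => gammaMeasure (α i) 1).map fun g i => g i / ∑ j, g j

/-- The uniform (Haar) distribution on orthogonal matrices. -/
def haarOrthogonal (d : ℕ) : Measure (Matrix.orthogonalGroup (Fin d) ℝ) :=
  Measure.haarMeasure ⊤

/-- The prior on index matrices: the law of `V diag(γ₁^{1/2}, …, γ_d^{1/2}) Vᵀ` with `V` a uniform
orthogonal matrix and `γ` an independent Dirichlet vector. -/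
def priorB {d : ℕ} (α : Fin d → ℝ) : Measure (Matrix (Fin d) (Fin d) ℝ) :=
  ((haarOrthogonal d).prod (dirichlet α)).map fun p =>
    (p.1 : Matrix (Fin d) (Fin d) ℝ) * Matrix.diagonal (fun i => √(p.2 i)) *
      (p.1 : Matrix (Fin d) (Fin d) ℝ).transpose

/-- The coefficient set `{β ∈ ℝᴹ : ∑ⱼ j |βⱼ| ≤ Λ, β_M ≠ 0}`; the coordinate `i : Fin M` holds
the coefficient with index `i + 1`. -/
def coeffSet (M : ℕ) (Λ : ℝ) : Set (Fin M → ℝ) :=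
  {β | ∑ i : Fin M, (((i : ℕ) : ℝ) + 1) * |β i| ≤ Λ ∧ ∀ i : Fin M, (i : ℕ) + 1 = M → β i ≠ 0}

/-- The map `(β₁, …, β_M) ↦ ∑ⱼ βⱼ φⱼ`. -/
def synth (M : ℕ) (β : Fin M → ℝ) : C(ℝ, ℝ) := ∑ i, β i • trig ((i : ℕ) + 1)

/-- The law of `∑ⱼ βⱼ φⱼ` for `β` uniform on the coefficient set. -/
def priorM (M : ℕ) (Λ : ℝ) : Measure C(ℝ, ℝ) :=
  (ProbabilityTheory.cond volume (coeffSet M Λ)).map (synth M)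

/-- The prior on link functions: the mixture of the laws `priorM M Λ`, `1 ≤ M ≤ n`, with weights
proportional to `10⁻ᴹ`. -/
def priorF (n : ℕ) (Λ : ℝ) : Measure C(ℝ, ℝ) :=
  ∑ M ∈ Finset.Icc 1 n,
    ENNReal.ofReal ((1 / 10) ^ M / ∑ m ∈ Finset.Icc 1 n, (1 / 10) ^ m) • priorM M Λ

/-- The prior on pairs (index matrix, link function). -/
def prior {d : ℕ} (n : ℕ) (α : Fin d → ℝ) (Λ : ℝ) :
    Measure (Matrix (Fin d) (Fin d) ℝ × C(ℝ, ℝ)) :=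
  (priorB α).prod (priorF n Λ)

/-! ### The Gibbs posterior -/

/-- The inverse temperature `λ = n / (w + 2 C₁)` with `w = 64 (C + 1) max(L, C + 1)` and
`C₁ = 8 ((C + 1)² + σ²)`. -/
def invTemp (n : ℕ) (L C σ : ℝ) : ℝ :=
  n / (64 * (C + 1) * max L (C + 1) + 2 * (8 * ((C + 1) ^ 2 + σ ^ 2)))

/-- The Gibbs posterior given the sample `D`: its density with respect to the prior is
`exp (-lam rₙ(B, f)) / ∫ exp (-lam rₙ) d(prior)`. -/
def gibbs {d n : ℕ} (α : Fin d → ℝ) (Λ lam : ℝ)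
    (D : Fin n → Matrix (Fin d) (Fin d) ℝ × ℝ) :
    Measure (Matrix (Fin d) (Fin d) ℝ × C(ℝ, ℝ)) :=
  (prior n α Λ).tilted fun θ => -lam * empRisk D θ.1 θ.2

/-- The joint law of `n` independent copies of `(X, Y)`. -/
def sampleLaw {Ω : Type*} [MeasurableSpace Ω] (μ : Measure Ω) {d : ℕ} (n : ℕ)
    (X : Ω → Matrix (Fin d) (Fin d) ℝ) (Y : Ω → ℝ) :
    Measure (Fin n → Matrix (Fin d) (Fin d) ℝ × ℝ) :=
  Measure.pi fun _ => μ.map fun ω => (X ω, Y ω)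

end LowRankSIM

end

open LowRankSIM

namespace LowRankSIM

/-! ### An abstract PAC-Bayesian deviation bound for Gibbs measures -/

section PacBayes

variable {S Θ : Type*} [MeasurableSpace S] [MeasurableSpace Θ]

/-! Put g = f⋆(⟨X, B⋆⟩) - f(⟨X, B⟩). As ε is centred given X, the excess risk of (B, f) is E g²
(`risk_sub_risk_eq_excess`), and the loss of one observation exceeds that of the truth by 2εg + g².
Under Bernstein's moment condition the fluctuation of 2εg is governed by g² itself. Hence, at the
inverse temperature λ = n/w, both exponential moments of λ times the empirical excess are controlled
by the excess risk E alone: at most exp(-λE/2) for the negative sign and exp(2λE) for the positive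
one (`lintegral_exp_relLoss_le`). This self-bounding is what yields rates of order 1/n instead of
1/√n.

The Gibbs mass of the bad set {E > b} is a numerator divided by a partition function. By Fubini the
numerator has expectation at most exp(-λb/2). The partition function is bounded below through any
set T of prior mass at least exp(-κ) on which E ≤ E₀. So a draw has excess risk of order E₀ + (κ +
log(2/δ))/λ (`gibbs_deviation`, `gibbs_excess_bound`).

It remains to exhibit T (`exists_neighbourhood`). For the matrix, pigeonhole and Haar invariance
handle the rank(B⋆) relevant eigenvectors, and gamma variables handle the eigenvalues, at a cost of
order rank(B⋆) d log(16n). For the link, the trigonometric series is truncated at a level M that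
balances the squared bias M^(-2k) against the cost M log n / n; the mixture over M contains this
level whatever k is, which is why the estimator adapts. If the claimed rate is not small,
boundedness of the links already suffices. -/

theorem tilted_neg_apply_le (π : Measure Θ) [SFinite π] {ℓ : Θ → ℝ}
    (hint : Integrable (fun θ => Real.exp (-ℓ θ)) π) {z : ℝ≥0∞} (hz : z ≠ 0)
    (hZ : z ≤ ∫⁻ θ, ENNReal.ofReal (Real.exp (-ℓ θ)) ∂π) (T : Set Θ) :
    π.tilted (fun θ => -ℓ θ) T ≤ (∫⁻ θ in T, ENNReal.ofReal (Real.exp (-ℓ θ)) ∂π) / z := by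
  have hZ' : ENNReal.ofReal (∫ θ, Real.exp (-ℓ θ) ∂π)
      = ∫⁻ θ, ENNReal.ofReal (Real.exp (-ℓ θ)) ∂π :=
    ofReal_integral_eq_lintegral_ofReal hint (ae_of_all _ fun _ => (Real.exp_pos _).le)
  have hpos : 0 < ∫ θ, Real.exp (-ℓ θ) ∂π := by
    rw [← ENNReal.ofReal_pos, hZ']
    exact lt_of_lt_of_le (pos_iff_ne_zero.2 hz) hZ
  rw [tilted_apply]
  simp_rw [ENNReal.ofReal_div_of_pos hpos, div_eq_mul_inv]
  rw [lintegral_mul_const', hZ']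
  · gcongr
  · rw [ENNReal.inv_ne_top, hZ', ← pos_iff_ne_zero]
    exact lt_of_lt_of_le (pos_iff_ne_zero.2 hz) hZ

/-- The lower bound on the partition function. The inequality s e^ℓ + s⁻¹ e^(-ℓ) ≥ 2, integrated
over T, plays the role of Jensen's inequality: if the first term contributes at most π(T), the
second contributes at least π(T). -/
theorem le_lintegral_exp_neg (π : Measure Θ) {ℓ : Θ → ℝ} (hℓ : Measurable ℓ) {T : Set Θ}
    (hTfin : π T ≠ ∞) {s : ℝ} (hs : 0 < s)
    (hF : ∫⁻ θ in T, ENNReal.ofReal (Real.exp (ℓ θ)) ∂π ≤ π T / ENNReal.ofReal s) :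
    ENNReal.ofReal s * π T ≤ ∫⁻ θ, ENNReal.ofReal (Real.exp (-ℓ θ)) ∂π := by
  have hs0 : ENNReal.ofReal s ≠ 0 := by simpa using hs
  have hst : ENNReal.ofReal s ≠ ∞ := ENNReal.ofReal_ne_top
  have key : 2 * π T ≤ ENNReal.ofReal s * (∫⁻ θ in T, ENNReal.ofReal (Real.exp (ℓ θ)) ∂π)
      + (ENNReal.ofReal s)⁻¹ * ∫⁻ θ in T, ENNReal.ofReal (Real.exp (-ℓ θ)) ∂π := by
    rw [← lintegral_const_mul _ (by fun_prop), ← lintegral_const_mul _ (by fun_prop),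
      ← lintegral_add_left (by fun_prop), ← setLIntegral_const]
    refine lintegral_mono fun θ => ?_
    rw [← ENNReal.ofReal_inv_of_pos hs, ← ENNReal.ofReal_mul hs.le,
      ← ENNReal.ofReal_mul (inv_nonneg.2 hs.le), ← ENNReal.ofReal_add (by positivity) (by positivity),
      show (2 : ℝ≥0∞) = ENNReal.ofReal 2 by simp]
    apply ENNReal.ofReal_le_ofReal
    have h1 : (s * Real.exp (ℓ θ)) * (s⁻¹ * Real.exp (-ℓ θ)) = 1 := by
      rw [Real.exp_neg]; field_simp
    nlinarith [sq_nonneg (s * Real.exp (ℓ θ) - s⁻¹ * Real.exp (-ℓ θ)),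
      mul_pos hs (Real.exp_pos (ℓ θ)), mul_pos (inv_pos.2 hs) (Real.exp_pos (-ℓ θ))]
  have h2 : ENNReal.ofReal s * (∫⁻ θ in T, ENNReal.ofReal (Real.exp (ℓ θ)) ∂π) ≤ π T :=
    (mul_le_mul_right hF _).trans (ENNReal.mul_div_le)
  have h3 : π T ≤ (ENNReal.ofReal s)⁻¹ * ∫⁻ θ, ENNReal.ofReal (Real.exp (-ℓ θ)) ∂π := by
    have : π T + π T ≤ π T + (ENNReal.ofReal s)⁻¹ *
        ∫⁻ θ, ENNReal.ofReal (Real.exp (-ℓ θ)) ∂π := by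
      rw [← two_mul]
      refine key.trans (add_le_add h2 ?_)
      gcongr
      exact Measure.restrict_le_self
    exact (ENNReal.add_le_add_iff_left hTfin).1 this
  calc ENNReal.ofReal s * π T ≤ _ := mul_le_mul_right h3 _
    _ = _ := by rw [← mul_assoc, ENNReal.mul_inv_cancel hs0 hst, one_mul]

theorem lintegral_lintegral_le_of_ae (P : Measure S) [IsProbabilityMeasure P] (π : Measure Θ)
    [IsProbabilityMeasure π] {f : S → Θ → ℝ≥0∞} (hf : Measurable (Function.uncurry f))
    {T : Set Θ} (hT : MeasurableSet T) {c : ℝ≥0∞}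
    (h : ∀ᵐ θ ∂π, θ ∈ T → ∫⁻ D, f D θ ∂P ≤ c) :
    ∫⁻ D, ∫⁻ θ in T, f D θ ∂π ∂P ≤ c * π T := by
  rw [lintegral_lintegral_swap hf.aemeasurable, ← setLIntegral_const]
  exact lintegral_mono_ae ((ae_restrict_iff' hT).2 h)

/-- The failure probability is split in two. Markov's inequality for the integral of e^ℓ over T
costs δ/2 and otherwise bounds the partition function below; then the expected posterior mass of the
bad set costs δ/2. Each half contributes one log(2/δ) to the condition on b. -/
theorem gibbs_deviation (P : Measure S) [IsProbabilityMeasure P] (π : Measure Θ)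
    [IsProbabilityMeasure π] (ℓ : S → Θ → ℝ) (hℓ : Measurable (Function.uncurry ℓ))
    (hint : ∀ D, Integrable (fun θ => Real.exp (-ℓ D θ)) π)
    (E : Θ → ℝ) (hE : Measurable E) {c : ℝ} (hc : 0 < c)
    (hlow : ∀ᵐ θ ∂π, ∫⁻ D, ENNReal.ofReal (Real.exp (-ℓ D θ)) ∂P
      ≤ ENNReal.ofReal (Real.exp (-(c * E θ))))
    (hup : ∀ᵐ θ ∂π, ∫⁻ D, ENNReal.ofReal (Real.exp (ℓ D θ)) ∂P
      ≤ ENNReal.ofReal (Real.exp (4 * c * E θ)))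
    {T : Set Θ} (hT : MeasurableSet T) {E₀ : ℝ} (hTE : ∀ θ ∈ T, E θ ≤ E₀)
    {κ : ℝ} (hκ : ENNReal.ofReal (Real.exp (-κ)) ≤ π T)
    {δ : ℝ} (hδ : 0 < δ) {b : ℝ}
    (hb : 4 * c * E₀ + κ + 2 * Real.log (2 / δ) ≤ c * b) :
    ENNReal.ofReal (1 - δ) ≤ ∫⁻ D, π.tilted (fun θ => -ℓ D θ) {θ | E θ ≤ b} ∂P := by
  -- Chosen so that Markov's inequality at level π(T)/s fails with probability at most s · exp(4cE₀)
  -- = δ/2.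
  set s : ℝ := δ / 2 * Real.exp (-(4 * c * E₀)) with hs_def
  have hs : 0 < s := by positivity
  have hs0 : ENNReal.ofReal s ≠ 0 := by simpa using hs
  have hst : ENNReal.ofReal s ≠ ∞ := ENNReal.ofReal_ne_top
  have hT0 : π T ≠ 0 := (lt_of_lt_of_le (by simpa using Real.exp_pos _) hκ).ne'
  have hTt : π T ≠ ∞ := measure_ne_top _ _
  have mexp : Measurable (Function.uncurry fun D θ => ENNReal.ofReal (Real.exp (ℓ D θ))) :=
    (Real.measurable_exp.comp hℓ).ennreal_ofReal
  have mexpn : Measurable (Function.uncurry fun D θ => ENNReal.ofReal (Real.exp (-ℓ D θ))) :=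
    (Real.measurable_exp.comp hℓ.neg).ennreal_ofReal
  set F : S → ℝ≥0∞ := fun D => ∫⁻ θ in T, ENNReal.ofReal (Real.exp (ℓ D θ)) ∂π with hF
  set bad : Set Θ := {θ | E θ ≤ b}ᶜ with hbad
  have hgm : MeasurableSet {θ | E θ ≤ b} := measurableSet_le hE measurable_const
  set N : S → ℝ≥0∞ := fun D => ∫⁻ θ in bad, ENNReal.ofReal (Real.exp (-ℓ D θ)) ∂π with hN
  have mF : Measurable F := mexp.lintegral_prod_right'
  have mN : Measurable N := mexpn.lintegral_prod_right'
  have hFint : ∫⁻ D, F D ∂P ≤ ENNReal.ofReal (Real.exp (4 * c * E₀)) * π T := by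
    refine lintegral_lintegral_le_of_ae P π mexp hT ?_
    filter_upwards [hup] with θ h hθ
    refine h.trans (ENNReal.ofReal_le_ofReal (Real.exp_le_exp.2 ?_))
    have := hTE θ hθ
    gcongr
  have hNint : ∫⁻ D, N D ∂P ≤ ENNReal.ofReal (Real.exp (-(c * b))) := by
    refine (lintegral_lintegral_le_of_ae P π mexpn hgm.compl
      (c := ENNReal.ofReal (Real.exp (-(c * b)))) ?_).trans ?_
    · filter_upwards [hlow] with θ h hθ
      refine h.trans (ENNReal.ofReal_le_ofReal (Real.exp_le_exp.2 ?_))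
      have : b < E θ := not_le.1 hθ
      have := mul_le_mul_of_nonneg_left this.le hc.le
      linarith
    · calc _ ≤ ENNReal.ofReal (Real.exp (-(c * b))) * 1 := by gcongr; exact prob_le_one
        _ = _ := mul_one _
  set B : Set S := {D | π T / ENNReal.ofReal s ≤ F D} with hB
  have mB : MeasurableSet B := measurableSet_le measurable_const mF
  have hPB : P B ≤ ENNReal.ofReal (δ / 2) := by
    have hne : π T / ENNReal.ofReal s ≠ 0 := by simp [ENNReal.div_eq_zero_iff, hT0]
    have hnt : π T / ENNReal.ofReal s ≠ ∞ := (ENNReal.div_lt_top hTt hs0).ne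
    refine (meas_ge_le_lintegral_div mF.aemeasurable hne hnt).trans ?_
    rw [ENNReal.div_le_iff hne hnt]
    refine hFint.trans (le_of_eq ?_)
    rw [div_eq_mul_inv (π T), ← ENNReal.ofReal_inv_of_pos hs, mul_comm (π T), ← mul_assoc,
      ← ENNReal.ofReal_mul (by positivity)]
    congr 2
    rw [hs_def, Real.exp_neg]
    field_simp
  -- A measurable majorant of the posterior mass of the bad set; with it, the posterior mass need
  -- not be shown measurable in the sample.
  set g : S → ℝ≥0∞ := fun D => B.indicator 1 D + N D / (ENNReal.ofReal s * π T) with hg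
  have mg : Measurable g := (measurable_one.indicator mB).add (mN.div_const _)
  have hgle : ∀ D, π.tilted (fun θ => -ℓ D θ) bad ≤ g D := by
    intro D
    have : NeZero π := ⟨IsProbabilityMeasure.ne_zero π⟩
    have : IsProbabilityMeasure (π.tilted fun θ => -ℓ D θ) := isProbabilityMeasure_tilted (hint D)
    by_cases hD : D ∈ B
    · simp only [hg, Set.indicator_of_mem hD, Pi.one_apply]
      exact prob_le_one.trans le_self_add
    · have hz := le_lintegral_exp_neg π (hℓ.of_uncurry_left (x := D)) hTt hs
        (not_le.1 hD).le
      exact (tilted_neg_apply_le π (hint D) (mul_ne_zero hs0 hT0) hz bad).trans le_add_self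
  have hgint : ∫⁻ D, g D ∂P ≤ ENNReal.ofReal δ := by
    rw [hg, lintegral_add_left (measurable_one.indicator mB), lintegral_indicator_one mB]
    simp_rw [div_eq_mul_inv]
    rw [lintegral_mul_const _ mN]
    have hκ' : ENNReal.ofReal (s * Real.exp (-κ)) ≤ ENNReal.ofReal s * π T := by
      rw [ENNReal.ofReal_mul hs.le]; gcongr
    have h2 : (∫⁻ D, N D ∂P) * (ENNReal.ofReal s * π T)⁻¹ ≤ ENNReal.ofReal (δ / 2) := by
      calc _ ≤ ENNReal.ofReal (Real.exp (-(c * b))) * (ENNReal.ofReal (s * Real.exp (-κ)))⁻¹ := by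
            gcongr
        _ = ENNReal.ofReal (Real.exp (-(c * b)) * (s * Real.exp (-κ))⁻¹) := by
            rw [← ENNReal.ofReal_inv_of_pos (by positivity), ← ENNReal.ofReal_mul (by positivity)]
        _ ≤ _ := by
            apply ENNReal.ofReal_le_ofReal
            rw [← div_eq_mul_inv, div_le_iff₀ (by positivity)]
            have h3 : δ / 2 * (s * Real.exp (-κ))
                = Real.exp (-(4 * c * E₀ + κ + 2 * Real.log (2 / δ))) := by
              have h4 : Real.exp (-(2 * Real.log (2 / δ))) = (δ / 2) ^ 2 := by
                rw [show -(2 * Real.log (2 / δ)) = Real.log ((δ / 2) ^ 2) by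
                  rw [Real.log_pow, ← inv_div, Real.log_inv]; push_cast; ring]
                exact Real.exp_log (by positivity)
              rw [neg_add, neg_add, Real.exp_add, Real.exp_add, h4, hs_def]
              ring
            rw [h3]
            exact Real.exp_le_exp.2 (by linarith)
    calc _ ≤ ENNReal.ofReal (δ / 2) + ENNReal.ofReal (δ / 2) := add_le_add hPB h2
      _ = ENNReal.ofReal δ := by rw [← ENNReal.ofReal_add (by positivity) (by positivity)]; ring_nf
  have htot : (1 : ℝ≥0∞) ≤ ∫⁻ D, π.tilted (fun θ => -ℓ D θ) {θ | E θ ≤ b} ∂P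
      + ENNReal.ofReal δ := by
    calc (1 : ℝ≥0∞) = ∫⁻ _, 1 ∂P := by simp
      _ ≤ ∫⁻ D, (π.tilted (fun θ => -ℓ D θ) {θ | E θ ≤ b} + g D) ∂P := by
          refine lintegral_mono fun D => ?_
          have : NeZero π := ⟨IsProbabilityMeasure.ne_zero π⟩
          have : IsProbabilityMeasure (π.tilted fun θ => -ℓ D θ) :=
            isProbabilityMeasure_tilted (hint D)
          refine le_trans ?_ (add_le_add le_rfl (hgle D))
          exact (prob_add_prob_compl hgm).ge
      _ = _ + ∫⁻ D, g D ∂P := lintegral_add_right _ mg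
      _ ≤ _ := by gcongr
  rw [ENNReal.ofReal_sub _ hδ.le, ENNReal.ofReal_one]
  exact tsub_le_iff_right.2 htot

end PacBayes

/-! ### Exponential moments under Bernstein's moment condition -/

section Moments

theorem exp_sub_one_sub_le (x : ℝ) :
    HasSum (fun k : ℕ => |x| ^ (k + 2) / ((k + 2)! : ℝ)) (Real.exp |x| - 1 - |x|) ∧
      Real.exp x - 1 - x ≤ Real.exp |x| - 1 - |x| := by
  have hs : ∀ y : ℝ, HasSum (fun k : ℕ => y ^ (k + 2) / ((k + 2)! : ℝ)) (Real.exp y - 1 - y) := by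
    intro y
    have h := NormedSpace.expSeries_div_hasSum_exp (𝔸 := ℝ) y
    rw [← Real.exp_eq_exp_ℝ] at h
    have h2 := (hasSum_nat_add_iff' 2).2 h
    simpa [Finset.sum_range_succ, sub_sub] using h2
  refine ⟨hs _, hasSum_le (fun k => ?_) (hs x) (hs |x|)⟩
  exact div_le_div_of_nonneg_right ((le_abs_self _).trans (abs_pow x _).le) (by positivity)

variable {Ω : Type*} {m m0 : MeasurableSpace Ω} {μ : Measure Ω}

theorem integrable_mul_of_bdd (hm : m ≤ m0) {u ψ : Ω → ℝ} (hu : StronglyMeasurable[m] u)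
    {K : ℝ} (hK : ∀ ω, |u ω| ≤ K) (hψ : Integrable ψ μ) :
    Integrable (fun ω => u ω * ψ ω) μ :=
  hψ.bdd_mul (hu.mono hm).aestronglyMeasurable (ae_of_all _ hK)

variable [IsProbabilityMeasure μ]

theorem integrable_of_bdd (hm : m ≤ m0) {u : Ω → ℝ} (hu : StronglyMeasurable[m] u)
    {K : ℝ} (hK : ∀ ω, |u ω| ≤ K) : Integrable u μ :=
  Integrable.of_bound (hu.mono hm).aestronglyMeasurable K (ae_of_all _ hK)

theorem integral_mul_eq_integral_mul_condExp (hm : m ≤ m0) {u ψ : Ω → ℝ}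
    (hu : StronglyMeasurable[m] u) {K : ℝ} (hK : ∀ ω, |u ω| ≤ K) (hψ : Integrable ψ μ) :
    ∫ ω, u ω * ψ ω ∂μ = ∫ ω, u ω * (μ[ψ|m]) ω ∂μ := by
  have h := condExp_mul_of_stronglyMeasurable_left hu (integrable_mul_of_bdd hm hu hK hψ) hψ
  rw [← integral_condExp hm]
  exact integral_congr_ae h

theorem integral_mul_le_of_condExp_le (hm : m ≤ m0) {u ψ : Ω → ℝ}
    (hu : StronglyMeasurable[m] u) (h0 : ∀ ω, 0 ≤ u ω) {K : ℝ} (hK : ∀ ω, |u ω| ≤ K)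
    (hψ : Integrable ψ μ) {c : ℝ} (hc : μ[ψ|m] ≤ᵐ[μ] fun _ => c) :
    ∫ ω, u ω * ψ ω ∂μ ≤ (∫ ω, u ω ∂μ) * c := by
  rw [integral_mul_eq_integral_mul_condExp hm hu hK hψ, ← integral_mul_const]
  refine integral_mono_ae (integrable_mul_of_bdd hm hu hK integrable_condExp)
    ((integrable_of_bdd hm hu hK).mul_const c) ?_
  filter_upwards [hc] with ω h
  exact mul_le_mul_of_nonneg_left h (h0 ω)

/-- Expand e^(aε): the linear term vanishes because ε has conditional mean zero, and the factorials
in the moment condition cancel those of the series. What is left is a geometric series of ratio a₀L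
≤ 1/2, whose sum 2 absorbs the factor 1/2 of the moment condition. The weight h is there to carry
the factor exp(±s g²) later. -/
theorem exp_moment_le (hm : m ≤ m0) {h a ε : Ω → ℝ} (hh : StronglyMeasurable[m] h)
    (h0 : ∀ ω, 0 ≤ h ω) {H : ℝ} (hH : ∀ ω, |h ω| ≤ H)
    (ha : StronglyMeasurable[m] a) {a₀ σ L : ℝ} (ha₀ : ∀ ω, |a ω| ≤ a₀) (hL : 0 < L)
    (haL : a₀ * L ≤ 1 / 2) (hε : Measurable ε) (hmean : μ[ε|m] =ᵐ[μ] 0)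
    (hN : ∀ k : ℕ, 2 ≤ k → Integrable (fun ω => |ε ω| ^ k) μ ∧
      μ[fun ω => |ε ω| ^ k|m] ≤ᵐ[μ] fun _ => (k ! : ℝ) / 2 * σ ^ 2 * L ^ (k - 2))
    (hε1 : Integrable ε μ) :
    Integrable (fun ω => h ω * Real.exp (a ω * ε ω)) μ ∧
      ∫ ω, h ω * Real.exp (a ω * ε ω) ∂μ ≤ ∫ ω, h ω * (1 + a ω ^ 2 * σ ^ 2) ∂μ := by
  have hΩ : Nonempty Ω := nonempty_of_isProbabilityMeasure μ
  have ha00 : 0 ≤ a₀ := (abs_nonneg _).trans (ha₀ hΩ.some)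
  have hH0 : 0 ≤ H := (abs_nonneg _).trans (hH hΩ.some)
  have mh : Measurable h := (hh.mono hm).measurable
  have ma : Measurable a := (ha.mono hm).measurable
  have hha2 : StronglyMeasurable[m] fun ω => h ω * a ω ^ 2 := hh.mul (ha.pow 2)
  have hha2b : ∀ ω, |h ω * a ω ^ 2| ≤ H * a₀ ^ 2 := by
    intro ω
    rw [abs_mul, abs_pow]
    have := hH ω
    have := ha₀ ω
    gcongr
  have hha : StronglyMeasurable[m] fun ω => h ω * a ω := hh.mul ha
  have hhab : ∀ ω, |h ω * a ω| ≤ H * a₀ := by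
    intro ω
    rw [abs_mul]
    have := hH ω
    have := ha₀ ω
    gcongr
  set q : ℝ := ∫ ω, h ω * a ω ^ 2 ∂μ with hq
  have hq0 : 0 ≤ q := integral_nonneg fun ω => mul_nonneg (h0 ω) (sq_nonneg _)
  have hterm : ∀ k : ℕ, ∫⁻ ω, ENNReal.ofReal (h ω * (|a ω * ε ω| ^ (k + 2) / ((k + 2)! : ℝ))) ∂μ
      ≤ ENNReal.ofReal (q * σ ^ 2 / 2 * (1 / 2) ^ k) := by
    intro k
    obtain ⟨hi, hc⟩ := hN (k + 2) (by omega)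
    have hum : StronglyMeasurable[m] fun ω => h ω * |a ω| ^ (k + 2) :=
      hh.mul (ha.norm.pow (k + 2))
    have hu0 : ∀ ω, 0 ≤ h ω * |a ω| ^ (k + 2) := fun ω => mul_nonneg (h0 ω) (by positivity)
    have hub : ∀ ω, |h ω * |a ω| ^ (k + 2)| ≤ H * a₀ ^ (k + 2) := by
      intro ω
      rw [abs_mul, abs_pow, abs_abs]
      have := hH ω
      have := ha₀ ω
      gcongr
    have heq : ∀ ω, h ω * (|a ω * ε ω| ^ (k + 2) / ((k + 2)! : ℝ))
        = (h ω * |a ω| ^ (k + 2) * |ε ω| ^ (k + 2)) / ((k + 2)! : ℝ) := by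
      intro ω
      rw [abs_mul, mul_pow]
      ring
    simp_rw [heq]
    rw [← ofReal_integral_eq_lintegral_ofReal
      ((integrable_mul_of_bdd hm hum hub hi).div_const _)
      (ae_of_all _ fun ω => div_nonneg (mul_nonneg (hu0 ω) (by positivity)) (by positivity))]
    apply ENNReal.ofReal_le_ofReal
    rw [integral_div, div_le_iff₀ (by positivity)]
    refine (integral_mul_le_of_condExp_le hm hum hu0 hub hi hc).trans ?_
    have h1 : ∫ ω, h ω * |a ω| ^ (k + 2) ∂μ ≤ q * a₀ ^ k := by
      rw [hq, ← integral_mul_const]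
      refine integral_mono (integrable_of_bdd hm hum hub)
        ((integrable_of_bdd hm hha2 hha2b).mul_const _) fun ω => ?_
      show h ω * |a ω| ^ (k + 2) ≤ h ω * a ω ^ 2 * a₀ ^ k
      rw [pow_add, sq_abs, mul_assoc, mul_comm (a ω ^ 2)]
      have := ha₀ ω
      have := h0 ω
      gcongr
    have h2 : a₀ ^ k * L ^ k ≤ (1 / 2) ^ k := by
      rw [← mul_pow]; gcongr
    simp only [Nat.add_sub_cancel]
    calc _ ≤ q * a₀ ^ k * (((k + 2)! : ℝ) / 2 * σ ^ 2 * L ^ k) := by gcongr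
      _ = q * σ ^ 2 / 2 * (a₀ ^ k * L ^ k) * ((k + 2)! : ℝ) := by ring
      _ ≤ _ := by gcongr
  have hψ0 : ∀ ω, 0 ≤ h ω * (Real.exp (a ω * ε ω) - 1 - a ω * ε ω) := fun ω =>
    mul_nonneg (h0 ω) (by linarith [Real.add_one_le_exp (a ω * ε ω)])
  -- The remainder is nonnegative, so Tonelli applies without prior integrability, and integrability
  -- follows from the bound.
  have hψ : ∫⁻ ω, ENNReal.ofReal (h ω * (Real.exp (a ω * ε ω) - 1 - a ω * ε ω)) ∂μ
      ≤ ENNReal.ofReal (q * σ ^ 2) := by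
    calc _ ≤ ∫⁻ ω, ∑' k : ℕ,
          ENNReal.ofReal (h ω * (|a ω * ε ω| ^ (k + 2) / ((k + 2)! : ℝ))) ∂μ := by
          refine lintegral_mono fun ω => ?_
          obtain ⟨hs, hle⟩ := exp_sub_one_sub_le (a ω * ε ω)
          have hs' := hs.mul_left (h ω)
          rw [← ENNReal.ofReal_tsum_of_nonneg
            (fun k => mul_nonneg (h0 ω) (by positivity)) hs'.summable, hs'.tsum_eq]
          exact ENNReal.ofReal_le_ofReal (mul_le_mul_of_nonneg_left hle (h0 ω))
      _ = ∑' k : ℕ, ∫⁻ ω, ENNReal.ofReal (h ω * (|a ω * ε ω| ^ (k + 2) / ((k + 2)! : ℝ))) ∂μ :=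
          lintegral_tsum fun k => by fun_prop
      _ ≤ ∑' k : ℕ, ENNReal.ofReal (q * σ ^ 2 / 2 * (1 / 2) ^ k) := ENNReal.tsum_le_tsum hterm
      _ = ENNReal.ofReal (q * σ ^ 2) := by
          have hg := hasSum_geometric_two.mul_left (q * σ ^ 2 / 2)
          rw [← ENNReal.ofReal_tsum_of_nonneg (fun k => by positivity) hg.summable, hg.tsum_eq]
          ring_nf
  have hψi : Integrable (fun ω => h ω * (Real.exp (a ω * ε ω) - 1 - a ω * ε ω)) μ := by
    refine ⟨by fun_prop, ?_⟩
    rw [hasFiniteIntegral_iff_ofReal (ae_of_all _ hψ0)]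
    exact hψ.trans_lt ENNReal.ofReal_lt_top
  have hψint : ∫ ω, h ω * (Real.exp (a ω * ε ω) - 1 - a ω * ε ω) ∂μ ≤ q * σ ^ 2 := by
    rw [integral_eq_lintegral_of_nonneg_ae (ae_of_all _ hψ0) hψi.1]
    exact ENNReal.toReal_le_of_le_ofReal (by positivity) hψ
  have hhi : Integrable h μ := integrable_of_bdd hm hh hH
  have hhai := integrable_mul_of_bdd hm hha hhab hε1
  have hzero : ∫ ω, h ω * a ω * ε ω ∂μ = 0 := by
    rw [integral_mul_eq_integral_mul_condExp hm hha hhab hε1]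
    refine integral_eq_zero_of_ae ?_
    filter_upwards [hmean] with ω hω
    simp [hω]
  have hdec : (fun ω => h ω * Real.exp (a ω * ε ω)) = fun ω =>
      (h ω + h ω * a ω * ε ω) + h ω * (Real.exp (a ω * ε ω) - 1 - a ω * ε ω) := by
    ext ω; ring
  have hdec2 : (fun ω => h ω * (1 + a ω ^ 2 * σ ^ 2)) = fun ω =>
      h ω + h ω * a ω ^ 2 * σ ^ 2 := by
    ext ω; ring
  have hsum : Integrable (fun ω => h ω + h ω * a ω * ε ω) μ := hhi.add hhai
  rw [hdec, hdec2]
  refine ⟨hsum.add hψi, ?_⟩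
  rw [integral_add hsum hψi, integral_add hhi hhai, hzero,
    integral_add hhi ((integrable_of_bdd hm hha2 hha2b).mul_const _), integral_mul_const]
  linarith

/-- With u = s g², integrating out the noise leaves e^(-u)(1 + u/4) and e^u(1 + u/4). These are at
most 1 - u/2 and 1 + 2u because u ≤ 1/16, and 1 + x ≤ e^x finishes after integration. The three
smallness conditions on s serve, in order, the convergence of the noise series, the bound on u and
the variance term u/4. -/
theorem lintegral_exp_excess_le (hm : m ≤ m0) {g ε : Ω → ℝ} (hg : StronglyMeasurable[m] g)
    {K L σ s : ℝ} (hgK : ∀ ω, |g ω| ≤ 2 * K) (hL : 0 < L) (hs : 0 < s)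
    (hsL : 64 * K * L * s ≤ 1) (hsK : 64 * K * K * s ≤ 1) (hsσ : 16 * σ ^ 2 * s ≤ 1)
    (hε : Measurable ε) (hmean : μ[ε|m] =ᵐ[μ] 0)
    (hN : ∀ k : ℕ, 2 ≤ k → Integrable (fun ω => |ε ω| ^ k) μ ∧
      μ[fun ω => |ε ω| ^ k|m] ≤ᵐ[μ] fun _ => (k ! : ℝ) / 2 * σ ^ 2 * L ^ (k - 2))
    (hε1 : Integrable ε μ) :
    ∫⁻ ω, ENNReal.ofReal (Real.exp (-(s * (2 * ε ω * g ω + g ω ^ 2)))) ∂μ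
        ≤ ENNReal.ofReal (Real.exp (-(s / 2 * ∫ ω, g ω ^ 2 ∂μ))) ∧
      ∫⁻ ω, ENNReal.ofReal (Real.exp (s * (2 * ε ω * g ω + g ω ^ 2))) ∂μ
        ≤ ENNReal.ofReal (Real.exp (2 * s * ∫ ω, g ω ^ 2 ∂μ)) := by
  have hg2 : ∀ ω, g ω ^ 2 ≤ 4 * K ^ 2 := fun ω => by
    have := abs_le.1 (hgK ω)
    nlinarith
  have hu0 : ∀ ω, 0 ≤ s * g ω ^ 2 := fun ω => by positivity
  have hu : ∀ ω, s * g ω ^ 2 ≤ 1 / 16 := fun ω => by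
    have := mul_le_mul_of_nonneg_left (hg2 ω) hs.le
    nlinarith
  have hgi : Integrable (fun ω => g ω ^ 2) μ :=
    integrable_of_bdd hm (hg.pow 2) (K := 4 * K ^ 2) fun ω => by
      rw [abs_of_nonneg (sq_nonneg _)]; exact hg2 ω
  have hvar : ∀ ω, (2 * s * g ω) ^ 2 * σ ^ 2 ≤ s * g ω ^ 2 / 4 := fun ω => by
    have := mul_le_mul_of_nonneg_left hsσ (hu0 ω)
    nlinarith
  have habs : ∀ ω, |2 * s * g ω| ≤ 4 * s * K := fun ω => by
    rw [abs_mul, abs_of_pos (by positivity : 0 < 2 * s)]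
    have := mul_le_mul_of_nonneg_left (hgK ω) (by positivity : 0 ≤ 2 * s)
    linarith
  have hLK : 4 * s * K * L ≤ 1 / 2 := by nlinarith
  have hgm : StronglyMeasurable[m] fun ω => s * g ω ^ 2 := (hg.pow 2).const_mul s
  constructor
  · obtain ⟨hi, hle⟩ := exp_moment_le (μ := μ) (h := fun ω => Real.exp (-(s * g ω ^ 2)))
      (a := fun ω => -(2 * s * g ω)) hm (Real.continuous_exp.comp_stronglyMeasurable hgm.neg)
      (fun ω => (Real.exp_pos _).le) (H := 1)
      (fun ω => by rw [Real.abs_exp]; exact Real.exp_le_one_iff.2 (neg_nonpos.2 (hu0 ω)))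
      (hg.const_mul (2 * s)).neg (fun ω => by rw [abs_neg]; exact habs ω) hL hLK hε hmean hN hε1
    have hexp : ∀ ω, Real.exp (-(s * (2 * ε ω * g ω + g ω ^ 2)))
        = Real.exp (-(s * g ω ^ 2)) * Real.exp (-(2 * s * g ω) * ε ω) := fun ω => by
      rw [← Real.exp_add]; ring_nf
    simp_rw [hexp]
    rw [← ofReal_integral_eq_lintegral_ofReal hi (ae_of_all _ fun ω => by positivity)]
    apply ENNReal.ofReal_le_ofReal
    refine hle.trans ?_
    calc _ ≤ ∫ ω, (1 - s / 2 * g ω ^ 2) ∂μ := by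
          refine integral_mono_of_nonneg (ae_of_all _ fun ω => by positivity)
            ((integrable_const _).sub (hgi.const_mul _)) (ae_of_all _ fun ω => ?_)
          have h1 : Real.exp (-(s * g ω ^ 2)) * (1 + s * g ω ^ 2) ≤ 1 := by
            rw [Real.exp_neg, inv_mul_le_one₀ (Real.exp_pos _), add_comm]
            exact Real.add_one_le_exp _
          have h2 := hvar ω
          have h3 := hu ω
          have h4 := hu0 ω
          have h5 := (Real.exp_pos (-(s * g ω ^ 2))).le
          show Real.exp (-(s * g ω ^ 2)) * (1 + (-(2 * s * g ω)) ^ 2 * σ ^ 2) ≤ 1 - s / 2 * g ω ^ 2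
          rw [neg_sq]
          -- Factored so that 1 + u can be absorbed by e^(-u).
          have h6 : 1 + (2 * s * g ω) ^ 2 * σ ^ 2
              ≤ (1 + s * g ω ^ 2) * (1 - s / 2 * g ω ^ 2) := by nlinarith
          calc _ ≤ Real.exp (-(s * g ω ^ 2)) * ((1 + s * g ω ^ 2) * (1 - s / 2 * g ω ^ 2)) := by
                gcongr
            _ = Real.exp (-(s * g ω ^ 2)) * (1 + s * g ω ^ 2) * (1 - s / 2 * g ω ^ 2) := by ring
            _ ≤ 1 * (1 - s / 2 * g ω ^ 2) := by
                gcongr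
                nlinarith
            _ = _ := one_mul _
      _ = 1 - s / 2 * ∫ ω, g ω ^ 2 ∂μ := by
          rw [integral_sub (integrable_const _) (hgi.const_mul _), integral_const_mul]; simp
      _ ≤ _ := by
          have := Real.add_one_le_exp (-(s / 2 * ∫ ω, g ω ^ 2 ∂μ))
          linarith
  · obtain ⟨hi, hle⟩ := exp_moment_le (μ := μ) (h := fun ω => Real.exp (s * g ω ^ 2))
      (a := fun ω => 2 * s * g ω) hm (Real.continuous_exp.comp_stronglyMeasurable hgm)
      (fun ω => (Real.exp_pos _).le) (H := Real.exp (1 / 16))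
      (fun ω => by rw [Real.abs_exp]; exact Real.exp_le_exp.2 (hu ω))
      (hg.const_mul (2 * s)) habs hL hLK hε hmean hN hε1
    have hexp : ∀ ω, Real.exp (s * (2 * ε ω * g ω + g ω ^ 2))
        = Real.exp (s * g ω ^ 2) * Real.exp (2 * s * g ω * ε ω) := fun ω => by
      rw [← Real.exp_add]; ring_nf
    simp_rw [hexp]
    rw [← ofReal_integral_eq_lintegral_ofReal hi (ae_of_all _ fun ω => by positivity)]
    apply ENNReal.ofReal_le_ofReal
    refine hle.trans ?_
    calc _ ≤ ∫ ω, (1 + 2 * s * g ω ^ 2) ∂μ := by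
          refine integral_mono_of_nonneg (ae_of_all _ fun ω => by positivity)
            ((integrable_const _).add (hgi.const_mul _)) (ae_of_all _ fun ω => ?_)
          have h1 : Real.exp (s * g ω ^ 2) * (1 - s * g ω ^ 2) ≤ 1 := by
            have := Real.add_one_le_exp (-(s * g ω ^ 2))
            calc _ ≤ Real.exp (s * g ω ^ 2) * Real.exp (-(s * g ω ^ 2)) := by gcongr; linarith
              _ = 1 := by rw [← Real.exp_add]; simp
          have h2 := hvar ω
          have h3 := hu ω
          have h4 := hu0 ω
          show Real.exp (s * g ω ^ 2) * (1 + (2 * s * g ω) ^ 2 * σ ^ 2) ≤ 1 + 2 * s * g ω ^ 2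
          have h6 : 1 + (2 * s * g ω) ^ 2 * σ ^ 2
              ≤ (1 - s * g ω ^ 2) * (1 + 2 * s * g ω ^ 2) := by nlinarith
          calc _ ≤ Real.exp (s * g ω ^ 2) * ((1 - s * g ω ^ 2) * (1 + 2 * s * g ω ^ 2)) := by
                gcongr
            _ = Real.exp (s * g ω ^ 2) * (1 - s * g ω ^ 2) * (1 + 2 * s * g ω ^ 2) := by ring
            _ ≤ 1 * (1 + 2 * s * g ω ^ 2) := by gcongr
            _ = _ := one_mul _
      _ = 1 + 2 * s * ∫ ω, g ω ^ 2 ∂μ := by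
          rw [integral_add (integrable_const _) (hgi.const_mul _), integral_const_mul]; simp
      _ ≤ _ := by
          have := Real.add_one_le_exp (2 * s * ∫ ω, g ω ^ 2 ∂μ)
          linarith

theorem lintegral_pi_exp_sum {S : Type*} [MeasurableSpace S] (P : Measure S)
    [IsProbabilityMeasure P] {v : S → ℝ} (hv : Measurable v) (n : ℕ) :
    ∫⁻ D, ENNReal.ofReal (Real.exp (∑ i, v (D i))) ∂(Measure.pi fun _ : Fin n => P)
      = (∫⁻ x, ENNReal.ofReal (Real.exp (v x)) ∂P) ^ n := by
  have mv : Measurable fun x => ENNReal.ofReal (Real.exp (v x)) := by fun_prop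
  have hind := iIndepFun_pi (μ := fun _ : Fin n => P)
    (X := fun _ : Fin n => fun x => ENNReal.ofReal (Real.exp (v x))) fun _ => mv.aemeasurable
  simp_rw [Real.exp_sum, ENNReal.ofReal_prod_of_nonneg (fun _ _ => (Real.exp_pos _).le)]
  rw [lintegral_prod_eq_prod_lintegral_of_indepFun Finset.univ _ hind
    fun i => mv.comp (measurable_pi_apply i)]
  have : ∀ i : Fin n, ∫⁻ D : Fin n → S, ENNReal.ofReal (Real.exp (v (D i)))
      ∂(Measure.pi fun _ : Fin n => P) = ∫⁻ x, ENNReal.ofReal (Real.exp (v x)) ∂P := fun i =>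
    (measurePreserving_eval (fun _ : Fin n => P) i).lintegral_comp mv
  simp_rw [this]
  simp

end Moments

/-! ### The prior on link functions -/

section LinkPrior

open scoped Pointwise

/-! ### Sup-norm and Lipschitz control by the weighted coefficient norm -/

theorem abs_trig_le_one (j : ℕ) (t : ℝ) : |trig j t| ≤ 1 := by
  unfold trig
  split_ifs
  · simp
  · exact Real.abs_cos_le_one _
  · exact Real.abs_sin_le_one _

theorem abs_trig_sub_le (j : ℕ) (x y : ℝ) :
    |trig j x - trig j y| ≤ Real.pi * j * |x - y| := by
  have hj : ((j / 2 : ℕ) : ℝ) ≤ j := by exact_mod_cast Nat.div_le_self j 2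
  have key : |Real.pi * ((j / 2 : ℕ) : ℝ) * x - Real.pi * ((j / 2 : ℕ) : ℝ) * y|
      ≤ Real.pi * j * |x - y| := by
    rw [← mul_sub, abs_mul, abs_of_nonneg (by positivity)]
    gcongr
  unfold trig
  split_ifs
  · simp only [ContinuousMap.one_apply, sub_self, abs_zero]; positivity
  · exact (Real.abs_cos_sub_cos_le _ _).trans key
  · exact (Real.abs_sin_sub_sin_le _ _).trans key

/-- The weighted `ℓ¹` norm `∑ⱼ j |βⱼ|`. -/
def wnorm {M : ℕ} (β : Fin M → ℝ) : ℝ := ∑ i : Fin M, (((i : ℕ) : ℝ) + 1) * |β i|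

theorem continuous_wnorm {M : ℕ} : Continuous (wnorm (M := M)) := by
  unfold wnorm; fun_prop

theorem sum_abs_le_wnorm {M : ℕ} (β : Fin M → ℝ) : ∑ i, |β i| ≤ wnorm β :=
  Finset.sum_le_sum fun i _ => by
    have : (0 : ℝ) ≤ ((i : ℕ) : ℝ) := by positivity
    nlinarith [abs_nonneg (β i)]

theorem wnorm_smul {M : ℕ} (c : ℝ) (β : Fin M → ℝ) : wnorm (c • β) = |c| * wnorm β := by
  simp only [wnorm, Pi.smul_apply, smul_eq_mul, abs_mul, Finset.mul_sum]
  exact Finset.sum_congr rfl fun i _ => by ring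

theorem wnorm_add_le {M : ℕ} (β γ : Fin M → ℝ) : wnorm (β + γ) ≤ wnorm β + wnorm γ := by
  simp only [wnorm, ← Finset.sum_add_distrib, ← mul_add]
  exact Finset.sum_le_sum fun i _ =>
    mul_le_mul_of_nonneg_left (abs_add_le _ _) (by positivity)

theorem synth_apply {M : ℕ} (β : Fin M → ℝ) (t : ℝ) :
    synth M β t = ∑ i, β i * trig ((i : ℕ) + 1) t := by
  simp [synth, ContinuousMap.sum_apply]

theorem abs_synth_le {M : ℕ} (β : Fin M → ℝ) (t : ℝ) : |synth M β t| ≤ wnorm β := by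
  rw [synth_apply]
  refine (Finset.abs_sum_le_sum_abs _ _).trans ((Finset.sum_le_sum fun i _ => ?_).trans
    (sum_abs_le_wnorm β))
  rw [abs_mul]
  exact mul_le_of_le_one_right (abs_nonneg _) (abs_trig_le_one _ _)

theorem abs_synth_sub_le {M : ℕ} (β : Fin M → ℝ) (x y : ℝ) :
    |synth M β x - synth M β y| ≤ Real.pi * wnorm β * |x - y| := by
  rw [synth_apply, synth_apply, ← Finset.sum_sub_distrib, wnorm, Finset.mul_sum, Finset.sum_mul]
  refine (Finset.abs_sum_le_sum_abs _ _).trans (Finset.sum_le_sum fun i _ => ?_)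
  rw [← mul_sub, abs_mul]
  have := abs_trig_sub_le ((i : ℕ) + 1) x y
  push_cast at this
  calc _ ≤ |β i| * (Real.pi * (((i : ℕ) : ℝ) + 1) * |x - y|) := by gcongr
    _ = _ := by ring

theorem synth_sub {M : ℕ} (β γ : Fin M → ℝ) (t : ℝ) :
    synth M β t - synth M γ t = synth M (β - γ) t := by
  simp only [synth_apply, ← Finset.sum_sub_distrib, Pi.sub_apply, sub_mul]

theorem measurable_synth (M : ℕ) : Measurable (synth M) := by
  refine Continuous.measurable ?_
  unfold synth
  fun_prop

/-! ### Volumes of weighted ℓ¹ balls -/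

theorem volume_wnorm_le_ne_top (M : ℕ) (Λ : ℝ) :
    volume {β : Fin M → ℝ | wnorm β ≤ Λ} ≠ ∞ := by
  have hsub : {β : Fin M → ℝ | wnorm β ≤ Λ} ⊆ Set.univ.pi fun _ => Set.Icc (-Λ) Λ := by
    intro β hβ i _
    refine abs_le.1 (le_trans ?_ hβ)
    refine le_trans ?_ (sum_abs_le_wnorm β)
    exact Finset.single_le_sum (f := fun i => |β i|) (fun i _ => abs_nonneg _) (Finset.mem_univ i)
  refine ne_top_of_le_ne_top ?_ (measure_mono hsub)
  exact (isCompact_univ_pi fun _ => isCompact_Icc).measure_lt_top.ne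

theorem volume_wnorm_le_pos (M : ℕ) {Λ : ℝ} (hΛ : 0 < Λ) :
    0 < volume {β : Fin M → ℝ | wnorm β ≤ Λ} := by
  have ho : IsOpen {β : Fin M → ℝ | wnorm β < Λ} := isOpen_lt continuous_wnorm continuous_const
  refine (ho.measure_pos volume ⟨0, ?_⟩).trans_le (measure_mono fun β (hβ : wnorm β < Λ) => hβ.le)
  simpa [wnorm] using hΛ

theorem measurableSet_coeffSet (M : ℕ) (Λ : ℝ) : MeasurableSet (coeffSet M Λ) := by
  refine MeasurableSet.inter (measurableSet_le continuous_wnorm.measurable measurable_const) ?_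
  have : {β : Fin M → ℝ | ∀ i : Fin M, (i : ℕ) + 1 = M → β i ≠ 0}
      = ⋂ i : Fin M, {β | (i : ℕ) + 1 = M → β i ≠ 0} := by ext; simp
  refine (congrArg MeasurableSet this).mpr (MeasurableSet.iInter fun i => ?_)
  by_cases h : (i : ℕ) + 1 = M
  · simp only [h, forall_const]
    exact (measurableSet_eq_fun (measurable_pi_apply i) measurable_const).compl
  · simp [h]

theorem ae_coeff_ne_zero (M : ℕ) :
    ∀ᵐ β : Fin M → ℝ, ∀ i : Fin M, (i : ℕ) + 1 = M → β i ≠ 0 := by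
  rw [ae_all_iff]
  intro i
  have h : volume {β : Fin M → ℝ | β i = 0} = 0 := Measure.pi_hyperplane _ i 0
  filter_upwards [measure_eq_zero_iff_ae_notMem.1 h] with β hβ _ using hβ

theorem volume_coeffSet (M : ℕ) (Λ : ℝ) :
    volume (coeffSet M Λ) = volume {β : Fin M → ℝ | wnorm β ≤ Λ} := by
  refine measure_congr ?_
  filter_upwards [ae_coeff_ne_zero M] with β hβ
  exact propext ⟨fun h => h.1, fun h => ⟨h, hβ⟩⟩

theorem volume_wnorm_sub_le (M : ℕ) (β₀ : Fin M → ℝ) {t Λ : ℝ} (ht : 0 < t) (hΛ : 0 < Λ) :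
    volume {β : Fin M → ℝ | wnorm (β - β₀) ≤ t}
      = ENNReal.ofReal ((t / Λ) ^ M) * volume {β : Fin M → ℝ | wnorm β ≤ Λ} := by
  have h1 : volume {β : Fin M → ℝ | wnorm (β - β₀) ≤ t} = volume {β : Fin M → ℝ | wnorm β ≤ t} := by
    have := measure_preimage_add_right volume (-β₀) {β : Fin M → ℝ | wnorm β ≤ t}
    simpa [← sub_eq_add_neg] using this
  have h2 : {β : Fin M → ℝ | wnorm β ≤ t} = (t / Λ) • {β : Fin M → ℝ | wnorm β ≤ Λ} := by
    have hpos : 0 < t / Λ := by positivity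
    ext β
    rw [Set.mem_smul_set_iff_inv_smul_mem₀ hpos.ne', Set.mem_ofPred_eq, Set.mem_ofPred_eq,
      wnorm_smul, abs_of_pos (inv_pos.2 hpos), inv_mul_le_iff₀ hpos, div_mul_cancel₀ _ hΛ.ne']
  rw [h1, h2, Measure.addHaar_smul, Module.finrank_fin_fun,
    abs_of_nonneg (pow_nonneg (by positivity) _)]

theorem isProbabilityMeasure_priorM (M : ℕ) {Λ : ℝ} (hΛ : 0 < Λ) :
    IsProbabilityMeasure (priorM M Λ) := by
  have : IsProbabilityMeasure (ProbabilityTheory.cond volume (coeffSet M Λ)) :=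
    cond_isProbabilityMeasure_of_finite
      (by rw [volume_coeffSet]; exact (volume_wnorm_le_pos M hΛ).ne')
      (by rw [volume_coeffSet]; exact volume_wnorm_le_ne_top M Λ)
  exact Measure.isProbabilityMeasure_map (measurable_synth M).aemeasurable

/-- The ball of radius t about β₀ lies in the ball of radius Λ, so its uniform mass is the volume
ratio (t/Λ)^M; the constraint on the last coefficient removes only a null set. -/
theorem le_cond_coeffSet (M : ℕ) {β₀ : Fin M → ℝ} {t Λ : ℝ} (ht : 0 < t)
    (h₀ : wnorm β₀ + t ≤ Λ) (hΛ : 0 < Λ) :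
    ENNReal.ofReal ((t / Λ) ^ M) ≤ ProbabilityTheory.cond volume (coeffSet M Λ)
      {β | wnorm (β - β₀) ≤ t ∧ wnorm β ≤ Λ} := by
  rw [cond_apply (measurableSet_coeffSet M Λ)]
  have h1 : volume (coeffSet M Λ ∩ {β | wnorm (β - β₀) ≤ t ∧ wnorm β ≤ Λ})
      = volume {β : Fin M → ℝ | wnorm (β - β₀) ≤ t} := by
    refine measure_congr ?_
    filter_upwards [ae_coeff_ne_zero M] with β hβ
    refine propext ⟨fun h => h.2.1, fun h => ?_⟩
    have h2 : wnorm β ≤ Λ := by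
      have := wnorm_add_le (β - β₀) β₀
      rw [sub_add_cancel] at this
      have h' : wnorm (β - β₀) ≤ t := h
      linarith
    exact ⟨⟨h2, hβ⟩, h, h2⟩
  rw [h1, volume_wnorm_sub_le M β₀ ht hΛ, volume_coeffSet, mul_comm, mul_assoc,
    ENNReal.mul_inv_cancel (volume_wnorm_le_pos M hΛ).ne' (volume_wnorm_le_ne_top M Λ), mul_one]

/-- Link functions that are bounded by `Λ` and Lipschitz with constant `π Λ`. -/
def tameLinks (Λ : ℝ) : Set C(ℝ, ℝ) :=
  {f | (∀ t, |f t| ≤ Λ) ∧ ∀ x y, |f x - f y| ≤ Real.pi * Λ * |x - y|}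

theorem measurableSet_tameLinks (Λ : ℝ) : MeasurableSet (tameLinks Λ) := by
  refine IsClosed.measurableSet ?_
  simp only [tameLinks, Set.ofPred_and, Set.ofPred_forall]
  refine IsClosed.inter (isClosed_iInter fun t => ?_)
    (isClosed_iInter fun x => isClosed_iInter fun y => ?_)
  · exact isClosed_le (by fun_prop) continuous_const
  · exact isClosed_le (by fun_prop) continuous_const

theorem measurableSet_uniform_ball (S : ℝ → ℝ) (η : ℝ) :
    MeasurableSet {f : C(ℝ, ℝ) | ∀ t, |f t - S t| ≤ η} := by
  refine IsClosed.measurableSet ?_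
  simp only [Set.ofPred_forall]
  exact isClosed_iInter fun t => isClosed_le (by fun_prop) continuous_const

theorem synth_mem_tameLinks {M : ℕ} {β : Fin M → ℝ} {Λ : ℝ} (h : wnorm β ≤ Λ) :
    synth M β ∈ tameLinks Λ := by
  refine ⟨fun t => (abs_synth_le β t).trans h, fun x y => (abs_synth_sub_le β x y).trans ?_⟩
  gcongr

theorem priorM_tameLinks (M : ℕ) (Λ : ℝ) : ∀ᵐ f ∂(priorM M Λ), f ∈ tameLinks Λ := by
  refine (ae_map_iff (measurable_synth M).aemeasurable (measurableSet_tameLinks Λ)).2 ?_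
  filter_upwards [ae_cond_mem (measurableSet_coeffSet M Λ)] with β hβ
  exact synth_mem_tameLinks hβ.1

theorem le_priorM (M : ℕ) {β₀ : Fin M → ℝ} {t Λ : ℝ} (ht : 0 < t)
    (h₀ : wnorm β₀ + t ≤ Λ) (hΛ : 0 < Λ) :
    ENNReal.ofReal ((t / Λ) ^ M) ≤
      priorM M Λ ({f | ∀ x, |f x - synth M β₀ x| ≤ t} ∩ tameLinks Λ) := by
  refine (le_cond_coeffSet M ht h₀ hΛ).trans ?_
  rw [priorM, Measure.map_apply (measurable_synth M)
    ((measurableSet_uniform_ball _ _).inter (measurableSet_tameLinks Λ))]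
  refine measure_mono fun β hβ => ⟨fun x => ?_, synth_mem_tameLinks hβ.2⟩
  rw [synth_sub]
  exact (abs_synth_le _ _).trans hβ.1

/-! ### The mixture over the number of coefficients -/

theorem sum_weights_pos {n : ℕ} (hn : 1 ≤ n) :
    0 < ∑ m ∈ Finset.Icc 1 n, ((1 : ℝ) / 10) ^ m :=
  Finset.sum_pos (fun _ _ => by positivity) ⟨1, Finset.mem_Icc.2 ⟨le_rfl, hn⟩⟩

theorem sum_weights_le_one (n : ℕ) : ∑ m ∈ Finset.Icc 1 n, ((1 : ℝ) / 10) ^ m ≤ 1 := by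
  have h : ∀ n : ℕ, ∑ m ∈ Finset.Icc 1 n, ((1 : ℝ) / 10) ^ m ≤ 1 - (1 / 10) ^ n := by
    intro n
    induction n with
    | zero => simp
    | succ n ih =>
      rw [Finset.sum_Icc_succ_top (by omega), pow_succ]
      have : (0 : ℝ) < (1 / 10) ^ n := by positivity
      linarith
  have : (0 : ℝ) < (1 / 10) ^ n := by positivity
  linarith [h n]

theorem isProbabilityMeasure_priorF {n : ℕ} (hn : 1 ≤ n) {Λ : ℝ} (hΛ : 0 < Λ) :
    IsProbabilityMeasure (priorF n Λ) := by
  constructor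
  simp only [priorF, Measure.coe_finsetSum, Finset.sum_apply, Measure.smul_apply, smul_eq_mul]
  have h1 : ∀ M, priorM M Λ Set.univ = 1 := fun M =>
    (isProbabilityMeasure_priorM M hΛ).measure_univ
  simp_rw [h1, mul_one]
  rw [← ENNReal.ofReal_sum_of_nonneg (fun i _ => by positivity), ← Finset.sum_div,
    div_self (sum_weights_pos hn).ne', ENNReal.ofReal_one]

theorem priorF_tameLinks (n : ℕ) (Λ : ℝ) : ∀ᵐ f ∂(priorF n Λ), f ∈ tameLinks Λ := by
  rw [ae_iff]
  simp only [priorF, Measure.coe_finsetSum, Finset.sum_apply, Measure.smul_apply, smul_eq_mul]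
  refine Finset.sum_eq_zero fun M _ => ?_
  rw [ae_iff.1 (priorM_tameLinks M Λ), mul_zero]

/-- Only the component M of the mixture is kept. The weights 10^(-m) sum to at most 1, so
normalizing them can only help; the price of not knowing M is the factor 10^(-M). -/
theorem le_priorF {n M : ℕ} (hM : 1 ≤ M) (hMn : M ≤ n) {β₀ : Fin M → ℝ} {t Λ : ℝ} (ht : 0 < t)
    (h₀ : wnorm β₀ + t ≤ Λ) (hΛ : 0 < Λ) :
    ENNReal.ofReal ((t / (10 * Λ)) ^ M) ≤
      priorF n Λ ({f | ∀ x, |f x - synth M β₀ x| ≤ t} ∩ tameLinks Λ) := by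
  simp only [priorF, Measure.coe_finsetSum, Finset.sum_apply, Measure.smul_apply, smul_eq_mul]
  have hmem : M ∈ Finset.Icc 1 n := Finset.mem_Icc.2 ⟨hM, hMn⟩
  refine le_trans ?_ (Finset.single_le_sum (fun _ _ => zero_le) hmem)
  have hw : ((1 : ℝ) / 10) ^ M ≤ (1 / 10) ^ M / ∑ m ∈ Finset.Icc 1 n, ((1 : ℝ) / 10) ^ m :=
    le_div_self (by positivity) (sum_weights_pos (hM.trans hMn)) (sum_weights_le_one n)
  have he : (t / (10 * Λ)) ^ M = (1 / 10) ^ M * (t / Λ) ^ M := by rw [← mul_pow]; ring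
  rw [he, ENNReal.ofReal_mul (by positivity)]
  exact mul_le_mul' (ENNReal.ofReal_le_ofReal hw) (le_priorM M ht h₀ hΛ)

end LinkPrior

/-! ### Truncation of the trigonometric series -/

section Fourier

open intervalIntegral

theorem integral_cos_pi_mul_int (p : ℤ) :
    ∫ t in (-1 : ℝ)..1, Real.cos (Real.pi * p * t) = if p = 0 then 2 else 0 := by
  split_ifs with h
  · simp [h]; norm_num
  · have hp : Real.pi * (p : ℝ) ≠ 0 := mul_ne_zero Real.pi_ne_zero (by exact_mod_cast h)
    have h1 : Real.sin (Real.pi * p) = 0 := by rw [mul_comm]; exact Real.sin_int_mul_pi p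
    rw [integral_comp_mul_left (fun x => Real.cos x) hp, integral_cos]
    simp [h1]

theorem integral_sin_pi_mul_int (p : ℤ) :
    ∫ t in (-1 : ℝ)..1, Real.sin (Real.pi * p * t) = 0 := by
  by_cases h : p = 0
  · simp [h]
  · have hp : Real.pi * (p : ℝ) ≠ 0 := mul_ne_zero Real.pi_ne_zero (by exact_mod_cast h)
    rw [integral_comp_mul_left (fun x => Real.sin x) hp, integral_sin]
    simp

theorem trig_eq {j : ℕ} (hj : 2 ≤ j) (t : ℝ) :
    trig j t = if Even j then Real.cos (Real.pi * ((j / 2 : ℕ) : ℤ) * t)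
      else Real.sin (Real.pi * ((j / 2 : ℕ) : ℤ) * t) := by
  unfold trig
  rw [if_neg (by omega)]
  split_ifs <;> simp only [Int.cast_natCast, ContinuousMap.coe_mk]

theorem integral_trig_mul_trig {i j : ℕ} (hi : 2 ≤ i) (hj : 2 ≤ j) :
    ∫ t in (-1 : ℝ)..1, trig i t * trig j t = if i = j then 1 else 0 := by
  have hcc : ∀ p q : ℤ, ∫ t in (-1 : ℝ)..1, Real.cos (Real.pi * p * t) * Real.cos (Real.pi * q * t)
      = ((if p - q = 0 then 2 else 0) + (if p + q = 0 then 2 else 0)) / 2 := by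
    intro p q
    rw [← integral_cos_pi_mul_int, ← integral_cos_pi_mul_int,
      ← integral_add (Continuous.intervalIntegrable (by fun_prop) _ _)
        (Continuous.intervalIntegrable (by fun_prop) _ _), ← intervalIntegral.integral_div]
    refine integral_congr fun t _ => ?_
    have h1 := Real.cos_sub (Real.pi * p * t) (Real.pi * q * t)
    have h2 := Real.cos_add (Real.pi * p * t) (Real.pi * q * t)
    have e1 : Real.pi * ((p - q : ℤ) : ℝ) * t = Real.pi * p * t - Real.pi * q * t := by
      push_cast; ring
    have e2 : Real.pi * ((p + q : ℤ) : ℝ) * t = Real.pi * p * t + Real.pi * q * t := by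
      push_cast; ring
    simp only [e1, e2, h1, h2]
    ring
  have hss : ∀ p q : ℤ, ∫ t in (-1 : ℝ)..1, Real.sin (Real.pi * p * t) * Real.sin (Real.pi * q * t)
      = ((if p - q = 0 then 2 else 0) - (if p + q = 0 then 2 else 0)) / 2 := by
    intro p q
    rw [← integral_cos_pi_mul_int, ← integral_cos_pi_mul_int,
      ← integral_sub (Continuous.intervalIntegrable (by fun_prop) _ _)
        (Continuous.intervalIntegrable (by fun_prop) _ _), ← intervalIntegral.integral_div]
    refine integral_congr fun t _ => ?_
    have h1 := Real.cos_sub (Real.pi * p * t) (Real.pi * q * t)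
    have h2 := Real.cos_add (Real.pi * p * t) (Real.pi * q * t)
    have e1 : Real.pi * ((p - q : ℤ) : ℝ) * t = Real.pi * p * t - Real.pi * q * t := by
      push_cast; ring
    have e2 : Real.pi * ((p + q : ℤ) : ℝ) * t = Real.pi * p * t + Real.pi * q * t := by
      push_cast; ring
    simp only [e1, e2, h1, h2]
    ring
  have hsc : ∀ p q : ℤ, ∫ t in (-1 : ℝ)..1, Real.sin (Real.pi * p * t) * Real.cos (Real.pi * q * t)
      = 0 := by
    intro p q
    have h0 : (0 : ℝ) = ((∫ t in (-1 : ℝ)..1, Real.sin (Real.pi * (p - q : ℤ) * t))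
        + ∫ t in (-1 : ℝ)..1, Real.sin (Real.pi * (p + q : ℤ) * t)) / 2 := by
      rw [integral_sin_pi_mul_int, integral_sin_pi_mul_int]; simp
    rw [h0, ← integral_add (Continuous.intervalIntegrable (by fun_prop) _ _)
        (Continuous.intervalIntegrable (by fun_prop) _ _), ← intervalIntegral.integral_div]
    refine integral_congr fun t _ => ?_
    have h1 := Real.sin_sub (Real.pi * p * t) (Real.pi * q * t)
    have h2 := Real.sin_add (Real.pi * p * t) (Real.pi * q * t)
    have e1 : Real.pi * ((p - q : ℤ) : ℝ) * t = Real.pi * p * t - Real.pi * q * t := by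
      push_cast; ring
    have e2 : Real.pi * ((p + q : ℤ) : ℝ) * t = Real.pi * p * t + Real.pi * q * t := by
      push_cast; ring
    simp only [e1, e2, h1, h2]
    ring
  simp_rw [trig_eq hi, trig_eq hj]
  by_cases ei : Even i <;> by_cases ej : Even j
  · simp only [ei, ej, if_true]
    rw [hcc]
    obtain ⟨a, rfl⟩ := ei
    obtain ⟨b, rfl⟩ := ej
    have h1 : (((a + a) / 2 : ℕ) : ℤ) + (((b + b) / 2 : ℕ) : ℤ) ≠ 0 := by omega
    have h2 : ((((a + a) / 2 : ℕ) : ℤ) - (((b + b) / 2 : ℕ) : ℤ) = 0) ↔ a + a = b + b := by omega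
    simp only [h1, h2, if_false]
    split_ifs <;> norm_num
  · simp only [ei, ej, if_true, if_false]
    simp_rw [mul_comm (Real.cos _)]
    rw [hsc, if_neg]
    rintro rfl
    exact ej ei
  · simp only [ei, ej, if_true, if_false]
    rw [hsc, if_neg]
    rintro rfl
    exact ei ej
  · simp only [ei, ej, if_false]
    rw [hss]
    obtain ⟨a, rfl⟩ := Nat.not_even_iff_odd.1 ei
    obtain ⟨b, rfl⟩ := Nat.not_even_iff_odd.1 ej
    have h1 : (((2 * a + 1) / 2 : ℕ) : ℤ) + (((2 * b + 1) / 2 : ℕ) : ℤ) ≠ 0 := by omega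
    have h2 : ((((2 * a + 1) / 2 : ℕ) : ℤ) - (((2 * b + 1) / 2 : ℕ) : ℤ) = 0)
        ↔ 2 * a + 1 = 2 * b + 1 := by omega
    simp only [h1, h2, if_false]
    split_ifs <;> norm_num

/-- Index 0 is excluded because it stands for the constant function, whose squared norm on [-1, 1]
is 2 and not 1. -/
theorem integral_sq_sum_trig {s : Finset ℕ} (hs : ∀ j ∈ s, 1 ≤ j) (β : ℕ → ℝ) :
    ∫ t in (-1 : ℝ)..1, (∑ j ∈ s, β j * trig (j + 1) t) ^ 2 = ∑ j ∈ s, β j ^ 2 := by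
  have hexp : ∀ t, (∑ j ∈ s, β j * trig (j + 1) t) ^ 2
      = ∑ i ∈ s, ∑ j ∈ s, (β i * β j) * (trig (i + 1) t * trig (j + 1) t) := by
    intro t
    rw [sq, Finset.sum_mul_sum]
    exact Finset.sum_congr rfl fun i _ => Finset.sum_congr rfl fun j _ => by ring
  simp_rw [hexp]
  rw [integral_finsetSum fun i _ => Continuous.intervalIntegrable (by fun_prop) _ _]
  refine Finset.sum_congr rfl fun i hi => ?_
  rw [integral_finsetSum fun j _ => Continuous.intervalIntegrable (by fun_prop) _ _]
  have : ∀ j ∈ s, ∫ t in (-1 : ℝ)..1, (β i * β j) * (trig (i + 1) t * trig (j + 1) t)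
      = if i = j then β i * β j else 0 := by
    intro j hj
    rw [intervalIntegral.integral_const_mul, integral_trig_mul_trig (by have := hs i hi; omega)
      (by have := hs j hj; omega)]
    by_cases h : i = j <;> simp [h]
  rw [Finset.sum_congr rfl this, Finset.sum_ite_eq]
  simp [hi, sq]

/-- The squared `L²([-1, 1])` distance of an element of a Sobolev ellipsoid to the truncation of
its trigonometric series. -/
theorem lintegral_sq_sub_truncation_le {k Q : ℝ} (hk : 0 ≤ k) {f : ℝ → ℝ} {β : ℕ → ℝ}
    (hf : MemLp f 2 (volume.restrict (Set.Icc (-1 : ℝ) 1)))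
    (hlim : Tendsto (fun N : ℕ => eLpNorm
      (fun t => f t - ∑ j ∈ Finset.range N, β j * trig (j + 1) t) 2
      (volume.restrict (Set.Icc (-1 : ℝ) 1))) atTop (𝓝 0))
    (hsum : Summable (fun j : ℕ => ((j : ℝ) + 1) ^ (2 * k) * β j ^ 2))
    (hQ : ∑' j : ℕ, ((j : ℝ) + 1) ^ (2 * k) * β j ^ 2 ≤ Q) {M : ℕ} (hM : 1 ≤ M) :
    ∫⁻ t in Set.Icc (-1 : ℝ) 1,
        ENNReal.ofReal ((f t - ∑ j ∈ Finset.range M, β j * trig (j + 1) t) ^ 2)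
      ≤ ENNReal.ofReal (Q * ((M : ℝ) + 1) ^ (-(2 * k))) := by
  set ν := volume.restrict (Set.Icc (-1 : ℝ) 1) with hν
  set S : ℕ → ℝ → ℝ := fun N t => ∑ j ∈ Finset.range N, β j * trig (j + 1) t with hS
  have hSc : ∀ N, Continuous (S N) := fun N => by simp only [hS]; fun_prop
  have hsq : ∀ u : ℝ → ℝ, eLpNorm u 2 ν ^ (2 : ℝ) = ∫⁻ t, ENNReal.ofReal (u t ^ 2) ∂ν := by
    intro u
    have := eLpNorm_nnreal_pow_eq_lintegral (f := u) (μ := ν) (p := 2) two_ne_zero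
    simp only [NNReal.coe_ofNat, ENNReal.coe_ofNat] at this
    rw [this]
    refine lintegral_congr fun t => ?_
    rw [ENNReal.rpow_two, ← ofReal_norm, ← ENNReal.ofReal_pow (norm_nonneg _),
      Real.norm_eq_abs, sq_abs]
  have hQ0 : 0 ≤ Q := le_trans (tsum_nonneg fun j => by positivity) hQ
  have htail : ∀ N, M ≤ N → eLpNorm (fun t => S N t - S M t) 2 ν ^ (2 : ℝ)
      ≤ ENNReal.ofReal (Q * ((M : ℝ) + 1) ^ (-(2 * k))) := by
    intro N hN
    have hdiff : ∀ t, S N t - S M t = ∑ j ∈ Finset.Ico M N, β j * trig (j + 1) t := fun t =>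
      (Finset.sum_Ico_eq_sub (fun j => β j * trig (j + 1) t) hN).symm
    simp_rw [hsq, hdiff]
    rw [← ofReal_integral_eq_lintegral_ofReal
      ((Continuous.continuousOn (by fun_prop)).integrableOn_compact isCompact_Icc)
      (ae_of_all _ fun _ => sq_nonneg _)]
    apply ENNReal.ofReal_le_ofReal
    rw [integral_Icc_eq_integral_Ioc, ← integral_of_le (by norm_num),
      integral_sq_sum_trig fun j hj => hM.trans (Finset.mem_Ico.1 hj).1]
    have hb : ∀ j ∈ Finset.Ico M N, β j ^ 2
        ≤ ((j : ℝ) + 1) ^ (2 * k) * β j ^ 2 * ((M : ℝ) + 1) ^ (-(2 * k)) := by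
      intro j hj
      have hMj : (M : ℝ) + 1 ≤ (j : ℝ) + 1 := by
        have : (M : ℝ) ≤ j := by exact_mod_cast (Finset.mem_Ico.1 hj).1
        linarith
      rw [Real.rpow_neg (by positivity), ← div_eq_mul_inv, le_div_iff₀ (by positivity), mul_comm]
      gcongr
    refine (Finset.sum_le_sum hb).trans ?_
    rw [← Finset.sum_mul]
    gcongr
    exact (hsum.sum_le_tsum _ fun j _ => by positivity).trans hQ
  set τ := ENNReal.ofReal (Q * ((M : ℝ) + 1) ^ (-(2 * k))) with hτ
  -- The bound on S N - S M is uniform in N, so it passes to the L² limit by the triangle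
  -- inequality.
  have hdist : eLpNorm (fun t => f t - S M t) 2 ν ≤ τ ^ (1 / 2 : ℝ) := by
    have hle : ∀ᶠ N in atTop, eLpNorm (fun t => f t - S M t) 2 ν
        ≤ eLpNorm (fun t => f t - S N t) 2 ν + τ ^ (1 / 2 : ℝ) := by
      filter_upwards [eventually_ge_atTop M] with N hN
      have h1 : (fun t => f t - S M t) = (fun t => f t - S N t) + fun t => S N t - S M t := by
        ext t; simp
      rw [h1]
      refine (eLpNorm_add_le (hf.1.sub (hSc N).aestronglyMeasurable)
        ((hSc N).sub (hSc M)).aestronglyMeasurable (by norm_num)).trans ?_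
      refine add_le_add le_rfl ?_
      have := ENNReal.rpow_le_rpow (htail N hN) (by norm_num : (0 : ℝ) ≤ 1 / 2)
      rwa [← ENNReal.rpow_mul, mul_one_div_cancel two_ne_zero, ENNReal.rpow_one] at this
    have := ge_of_tendsto (hlim.add_const (τ ^ (1 / 2 : ℝ))) hle
    rwa [zero_add] at this
  have := ENNReal.rpow_le_rpow hdist (by norm_num : (0 : ℝ) ≤ 2)
  rwa [← ENNReal.rpow_mul, one_div_mul_cancel two_ne_zero, ENNReal.rpow_one, hsq] at this

theorem sum_inv_sq_le (N : ℕ) :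
    ∑ j ∈ Finset.range N, 1 / ((j : ℝ) + 1) ^ 2 ≤ Real.pi ^ 2 / 6 := by
  have h := (hasSum_nat_add_iff' 1).2 hasSum_zeta_two
  simp only [Finset.sum_range_one, Nat.cast_zero, ne_eq, OfNat.ofNat_ne_zero, not_false_eq_true,
    zero_pow, div_zero, sub_zero] at h
  have := h.summable.sum_le_tsum (Finset.range N) (fun j _ => by positivity)
  rw [h.tsum_eq] at this
  simpa using this

/-- Cauchy–Schwarz for j|βⱼ| = j²|βⱼ| · j⁻¹, with ∑ j⁻² = π²/6. This explains the radius 6C²/π² of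
the ellipsoid, and k ≥ 2 is what gives j⁴ ≤ j^(2k). Truncated series therefore lie in the support of
the prior, uniformly in the truncation level. -/
theorem sum_weighted_abs_le {k C : ℝ} (hk : 2 ≤ k) (hC : 0 ≤ C) {β : ℕ → ℝ}
    (hsum : Summable (fun j : ℕ => ((j : ℝ) + 1) ^ (2 * k) * β j ^ 2))
    (hQ : ∑' j : ℕ, ((j : ℝ) + 1) ^ (2 * k) * β j ^ 2 ≤ 6 * C ^ 2 / Real.pi ^ 2) (M : ℕ) :
    wnorm (fun i : Fin M => β i) ≤ C := by
  have hw : wnorm (fun i : Fin M => β i) = ∑ j ∈ Finset.range M, ((j : ℝ) + 1) * |β j| :=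
    (Finset.sum_range fun j => ((j : ℝ) + 1) * |β j|).symm
  rw [hw]
  have hcs := Finset.sum_mul_sq_le_sq_mul_sq (Finset.range M)
    (fun j => ((j : ℝ) + 1) ^ 2 * |β j|) (fun j => 1 / ((j : ℝ) + 1))
  have he : ∀ j ∈ Finset.range M, ((j : ℝ) + 1) ^ 2 * |β j| * (1 / ((j : ℝ) + 1))
      = ((j : ℝ) + 1) * |β j| := fun j _ => by
    have : ((j : ℝ) + 1) ≠ 0 := by positivity
    field_simp
  rw [Finset.sum_congr rfl he] at hcs
  have h1 : ∑ j ∈ Finset.range M, (((j : ℝ) + 1) ^ 2 * |β j|) ^ 2 ≤ 6 * C ^ 2 / Real.pi ^ 2 := by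
    refine le_trans (Finset.sum_le_sum fun j _ => ?_)
      ((hsum.sum_le_tsum (Finset.range M) fun j _ => by positivity).trans hQ)
    rw [mul_pow, sq_abs, ← pow_mul]
    gcongr
    rw [← Real.rpow_natCast]
    have : (0 : ℝ) ≤ j := by positivity
    exact Real.rpow_le_rpow_of_exponent_le (by linarith) (by push_cast; linarith)
  have h2 : ∑ j ∈ Finset.range M, (1 / ((j : ℝ) + 1)) ^ 2 ≤ Real.pi ^ 2 / 6 := by
    have := sum_inv_sq_le M
    simpa [div_pow] using this
  have h3 : (∑ j ∈ Finset.range M, ((j : ℝ) + 1) * |β j|) ^ 2 ≤ C ^ 2 := by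
    refine hcs.trans ?_
    calc _ ≤ 6 * C ^ 2 / Real.pi ^ 2 * (Real.pi ^ 2 / 6) :=
          mul_le_mul h1 h2 (by positivity) (by positivity)
      _ = C ^ 2 := by field_simp
  exact le_of_sq_le_sq h3 hC

end Fourier

/-! ### The prior on index matrices -/

section MatrixPrior

variable {d : ℕ}

instance isProbabilityMeasure_haarOrthogonal : IsProbabilityMeasure (haarOrthogonal d) :=
  ⟨by
    have := Measure.haarMeasure_self
      (K₀ := (⊤ : TopologicalSpace.PositiveCompacts (Matrix.orthogonalGroup (Fin d) ℝ)))
    simpa [haarOrthogonal] using this⟩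

instance isHaarMeasure_haarOrthogonal : (haarOrthogonal d).IsHaarMeasure := by
  unfold haarOrthogonal; infer_instance

theorem abs_orthogonal_le_one (V : Matrix.orthogonalGroup (Fin d) ℝ) (i j : Fin d) :
    |(V : Matrix (Fin d) (Fin d) ℝ) i j| ≤ 1 := by
  have h := entry_norm_bound_of_unitary (𝕜 := ℝ) V.2 i j
  rwa [Real.norm_eq_abs] at h

/-- The cell of a regular grid of `[-1, 1]` that contains `x`. -/
noncomputable def gridCell (m : ℕ) (x : ℝ) : Fin (m + 1) := Fin.ofNat (m + 1) ⌊(x + 1) / 2 * m⌋₊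

theorem abs_sub_le_of_gridCell_eq {m : ℕ} (hm : 1 ≤ m) {x y : ℝ} (hx : |x| ≤ 1) (hy : |y| ≤ 1)
    (h : gridCell m x = gridCell m y) : |x - y| ≤ 2 / m := by
  have hm0 : (0 : ℝ) < m := by exact_mod_cast hm
  have hlt : ∀ z : ℝ, |z| ≤ 1 → ⌊(z + 1) / 2 * m⌋₊ < m + 1 := fun z hz => by
    have hz' := abs_le.1 hz
    refine Nat.lt_succ_of_le (Nat.floor_le_of_le ?_)
    nlinarith
  have hf : ⌊(x + 1) / 2 * m⌋₊ = ⌊(y + 1) / 2 * m⌋₊ := by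
    have := congrArg Fin.val h
    simpa [gridCell, Fin.ofNat, Nat.mod_eq_of_lt (hlt x hx), Nat.mod_eq_of_lt (hlt y hy)] using this
  have hx' := abs_le.1 hx
  have hy' := abs_le.1 hy
  have h1 := Nat.floor_le (a := (x + 1) / 2 * m) (mul_nonneg (by linarith) hm0.le)
  have h2 := Nat.floor_le (a := (y + 1) / 2 * m) (mul_nonneg (by linarith) hm0.le)
  have h3 := Nat.lt_floor_add_one ((x + 1) / 2 * m)
  have h4 := Nat.lt_floor_add_one ((y + 1) / 2 * m)
  rw [hf] at h1 h3
  rw [abs_le, le_div_iff₀ hm0, neg_le, ← sub_nonneg]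
  constructor
  · rw [sub_nonneg, le_div_iff₀ hm0]; nlinarith
  · nlinarith

/-- Pigeonhole. The entries of the columns in s fall into one of (m+1)^(d|s|) grid cells, and these
cells cover the group. If V₀ lies in a cell, left translation by W V₀⁻¹ carries the whole cell into
the target neighbourhood of W, since its entries are at most 1 in absolute value. By invariance no
cell has more mass than the target, which is thus at least the average mass. Only the chosen columns
enter the exponent. -/
theorem le_haarOrthogonal_columns (s : Finset (Fin d)) (W : Matrix.orthogonalGroup (Fin d) ℝ)
    {m : ℕ} (hm : 1 ≤ m) :
    ENNReal.ofReal ((1 / ((m : ℝ) + 1)) ^ (d * s.card)) ≤ haarOrthogonal d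
      {V | ∀ k ∈ s, ∀ i, |(V : Matrix (Fin d) (Fin d) ℝ) i k
        - (W : Matrix (Fin d) (Fin d) ℝ) i k| ≤ d * (2 / m)} := by
  classical
  set T : Set (Matrix.orthogonalGroup (Fin d) ℝ) :=
    {V | ∀ k ∈ s, ∀ i, |(V : Matrix (Fin d) (Fin d) ℝ) i k
      - (W : Matrix (Fin d) (Fin d) ℝ) i k| ≤ d * (2 / m)} with hT
  let cell : Matrix.orthogonalGroup (Fin d) ℝ → (Fin d × s → Fin (m + 1)) :=
    fun V p => gridCell m ((V : Matrix (Fin d) (Fin d) ℝ) p.1 p.2)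
  have hcell : ∀ c, haarOrthogonal d (cell ⁻¹' {c}) ≤ haarOrthogonal d T := by
    intro c
    rcases Set.eq_empty_or_nonempty (cell ⁻¹' {c}) with h | ⟨V₀, hV₀⟩
    · simp [h]
    · rw [← measure_preimage_mul (haarOrthogonal d) (W * V₀⁻¹) T]
      refine measure_mono fun V hV k hk i => ?_
      have hW : (W : Matrix (Fin d) (Fin d) ℝ)
          = ((W * V₀⁻¹ : Matrix.orthogonalGroup (Fin d) ℝ) : Matrix (Fin d) (Fin d) ℝ)
            * (V₀ : Matrix (Fin d) (Fin d) ℝ) := by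
        rw [← Submonoid.coe_mul, inv_mul_cancel_right]
      rw [Submonoid.coe_mul]
      conv_lhs => rw [hW]
      rw [Matrix.mul_apply, Matrix.mul_apply, ← Finset.sum_sub_distrib]
      refine (Finset.abs_sum_le_sum_abs _ _).trans ?_
      calc _ ≤ ∑ _j : Fin d, (2 / m : ℝ) := by
            refine Finset.sum_le_sum fun j _ => ?_
            rw [← mul_sub, abs_mul]
            have h1 := abs_orthogonal_le_one (W * V₀⁻¹) i j
            have h2 : |(V : Matrix (Fin d) (Fin d) ℝ) j k
                - (V₀ : Matrix (Fin d) (Fin d) ℝ) j k| ≤ 2 / m := by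
              refine abs_sub_le_of_gridCell_eq hm (abs_orthogonal_le_one V j k)
                (abs_orthogonal_le_one V₀ j k) ?_
              have hVc : cell V = c := hV
              have hV₀c : cell V₀ = c := hV₀
              exact congrFun (hVc.trans hV₀c.symm) (j, ⟨k, hk⟩)
            calc _ ≤ 1 * (2 / m : ℝ) := by gcongr
              _ = _ := one_mul _
        _ = _ := by simp
  have hsum : (1 : ℝ≥0∞) ≤ ((m + 1) ^ (d * s.card) : ℕ) * haarOrthogonal d T := by
    calc (1 : ℝ≥0∞) = haarOrthogonal d (⋃ c, cell ⁻¹' {c}) := by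
          rw [← Set.preimage_iUnion, Set.iUnion_of_singleton, Set.preimage_univ, measure_univ]
      _ ≤ ∑ c, haarOrthogonal d (cell ⁻¹' {c}) := measure_iUnion_fintype_le _ _
      _ ≤ ∑ _c : Fin d × s → Fin (m + 1), haarOrthogonal d T := Finset.sum_le_sum fun c _ => hcell c
      _ = _ := by simp
  have hN : ENNReal.ofReal ((1 / ((m : ℝ) + 1)) ^ (d * s.card))
      = (((m + 1) ^ (d * s.card) : ℕ) : ℝ≥0∞)⁻¹ := by
    rw [one_div, inv_pow, ENNReal.ofReal_inv_of_pos (by positivity)]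
    congr 1
    rw [← ENNReal.ofReal_natCast]
    push_cast
    rfl
  rw [hN, ENNReal.inv_le_iff_le_mul]
  · exact hsum
  · intro _; simp
  · intro h; exact absurd h (ENNReal.natCast_ne_top _)

/-! ### Small balls under the Dirichlet law -/

theorem Gamma_le_inv {a : ℝ} (ha : 0 < a) (ha1 : a ≤ 1) : Real.Gamma a ≤ 1 / a := by
  have h1 : Real.Gamma (a + 1) ≤ 1 := by
    -- Γ is convex and Γ(1) = Γ(2) = 1, so Γ ≤ 1 on [1, 2].
    have hc := Real.convexOn_Gamma.2 (Set.mem_Ioi.2 one_pos) (Set.mem_Ioi.2 two_pos)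
      (sub_nonneg.2 ha1) ha.le (sub_add_cancel 1 a)
    have e : (1 - a) • (1 : ℝ) + a • (2 : ℝ) = a + 1 := by simp only [smul_eq_mul]; ring
    rw [e, Real.Gamma_one, Real.Gamma_two] at hc
    simpa using hc
  rw [Real.Gamma_add_one ha.ne'] at h1
  rw [le_div_iff₀ ha, mul_comm]
  exact h1

/-- On (0, 2] the density x^(a-1) e^(-x) / Γ(a) is at least (1/2) · e^(-2) · a; the singularity at 0
only helps. The proof passes to the half-open interval because the real power takes the value 0 at x
= 0 when a < 1. -/
theorem le_gammaMeasure_Icc {a c h : ℝ} (ha : 0 < a) (ha1 : a ≤ 1) (hc : 0 ≤ c)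
    (hch : c + h ≤ 2) :
    ENNReal.ofReal (h * a / (2 * Real.exp 2)) ≤ gammaMeasure a 1 (Set.Icc c (c + h)) := by
  rw [gammaMeasure, withDensity_apply _ measurableSet_Icc]
  calc ENNReal.ofReal (h * a / (2 * Real.exp 2))
      = ∫⁻ _ in Set.Ioc c (c + h), ENNReal.ofReal (a / (2 * Real.exp 2)) := by
        rw [setLIntegral_const, Real.volume_Ioc, ← ENNReal.ofReal_mul (by positivity)]
        congr 1; ring
    _ ≤ ∫⁻ x in Set.Ioc c (c + h), gammaPDF a 1 x := by
        refine setLIntegral_mono' measurableSet_Ioc fun x hx => ?_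
        have hx0 : 0 < x := hc.trans_lt hx.1
        have hx2 : x ≤ 2 := hx.2.trans hch
        refine ENNReal.ofReal_le_ofReal ?_
        rw [gammaPDFReal, if_pos hx0.le, Real.one_rpow, one_mul]
        have h1 : a ≤ 1 / Real.Gamma a := by
          rw [le_div_iff₀ (Real.Gamma_pos_of_pos ha), mul_comm, ← le_div_iff₀ ha]
          exact Gamma_le_inv ha ha1
        have h2 : 1 / 2 ≤ x ^ (a - 1) := by
          calc (1 / 2 : ℝ) = 2 ^ (-1 : ℝ) := by rw [Real.rpow_neg_one]; norm_num
            _ ≤ 2 ^ (a - 1) := Real.rpow_le_rpow_of_exponent_le (by norm_num) (by linarith)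
            _ ≤ x ^ (a - 1) := Real.rpow_le_rpow_of_nonpos hx0 hx2 (by linarith)
        have h3 : (Real.exp 2)⁻¹ ≤ Real.exp (-x) := by
          rw [← Real.exp_neg]; exact Real.exp_le_exp.2 (by linarith)
        calc a / (2 * Real.exp 2) = a * (1 / 2) * (Real.exp 2)⁻¹ := by field_simp
          _ ≤ _ := by gcongr
    _ ≤ _ := lintegral_mono_set Set.Ioc_subset_Icc_self

theorem isProbabilityMeasure_dirichlet {α : Fin d → ℝ} (hα : ∀ i, 0 < α i) :
    IsProbabilityMeasure (dirichlet α) := by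
  have : ∀ i, IsProbabilityMeasure (gammaMeasure (α i) 1) := fun i =>
    isProbabilityMeasure_gammaMeasure (hα i) one_pos
  exact Measure.isProbabilityMeasure_map (by fun_prop)

/-- Since c sums to 1, it can be targeted by the unnormalized gamma variables, which are
independent. If each lies in [cᵢ, cᵢ + h], their sum lies in [1, 1 + dh], and normalization keeps
every coordinate within dh of cᵢ. -/
theorem le_dirichlet {α : Fin d → ℝ} (hα : ∀ i, 0 < α i) (hα1 : ∀ i, α i ≤ 1) {c : Fin d → ℝ}
    (hc : ∀ i, 0 ≤ c i) (hc1 : ∑ i, c i = 1) {h : ℝ} (hh : 0 ≤ h) (hh1 : h ≤ 1) :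
    ENNReal.ofReal (∏ i, (h * α i / (2 * Real.exp 2)))
      ≤ dirichlet α {γ | ∀ i, |γ i - c i| ≤ d * h} := by
  have : ∀ i, IsProbabilityMeasure (gammaMeasure (α i) 1) := fun i =>
    isProbabilityMeasure_gammaMeasure (hα i) one_pos
  have hcle : ∀ i, c i ≤ 1 := fun i => by
    rw [← hc1]; exact Finset.single_le_sum (fun j _ => hc j) (Finset.mem_univ i)
  refine le_trans ?_ (Measure.le_map_apply (Measurable.aemeasurable (by fun_prop)) _)
  calc _ ≤ (Measure.pi fun i => gammaMeasure (α i) 1)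
        (Set.univ.pi fun i => Set.Icc (c i) (c i + h)) := by
        rw [Measure.pi_pi, ENNReal.ofReal_prod_of_nonneg fun i _ => by
          have := (hα i).le; positivity]
        exact Finset.prod_le_prod' fun i _ =>
          le_gammaMeasure_Icc (hα i) (hα1 i) (hc i) (by linarith [hcle i])
    _ ≤ _ := by
        refine measure_mono fun g hg i => ?_
        have hg' : ∀ j, c j ≤ g j ∧ g j ≤ c j + h := fun j => hg j (Set.mem_univ j)
        have hs1 : 1 ≤ ∑ j, g j := by rw [← hc1]; exact Finset.sum_le_sum fun j _ => (hg' j).1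
        have hs2 : ∑ j, g j ≤ 1 + d * h := by
          calc _ ≤ ∑ j, (c j + h) := Finset.sum_le_sum fun j _ => (hg' j).2
            _ = _ := by rw [Finset.sum_add_distrib, hc1]; simp
        have hs0 : 0 < ∑ j, g j := by linarith
        have hd : (1 : ℝ) ≤ d := by
          have : 0 < d := i.pos
          exact_mod_cast this
        have hdh : h ≤ d * h := le_mul_of_one_le_left hh hd
        show |g i / ∑ j, g j - c i| ≤ d * h
        rw [abs_le, neg_le_sub_iff_le_add, sub_le_iff_le_add, div_le_iff₀ hs0,
          ← sub_le_iff_le_add, le_div_iff₀ hs0]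
        obtain ⟨h1, h2⟩ := hg' i
        have h3 := hc i
        have h4 := hcle i
        constructor
        · have h5 : 0 ≤ (d : ℝ) * h * (∑ j, g j - c i) := by
            apply mul_nonneg (by positivity); linarith
          nlinarith [mul_nonneg h3 (sub_nonneg.2 hs2)]
        · nlinarith [mul_nonneg (add_nonneg (mul_nonneg (Nat.cast_nonneg d) hh) h3)
            (sub_nonneg.2 hs1)]

theorem measurable_priorB_map :
    Measurable fun p : Matrix.orthogonalGroup (Fin d) ℝ × (Fin d → ℝ) =>
      (p.1 : Matrix (Fin d) (Fin d) ℝ) * Matrix.diagonal (fun i => √(p.2 i)) *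
        (p.1 : Matrix (Fin d) (Fin d) ℝ).transpose := by
  refine Continuous.measurable ?_
  fun_prop

theorem isProbabilityMeasure_priorB {α : Fin d → ℝ} (hα : ∀ i, 0 < α i) :
    IsProbabilityMeasure (priorB α) := by
  have := isProbabilityMeasure_dirichlet hα
  exact Measure.isProbabilityMeasure_map measurable_priorB_map.aemeasurable

/-! ### Spectral coordinates and their perturbation -/

theorem conj_diagonal_apply (V : Matrix (Fin d) (Fin d) ℝ) (s : Fin d → ℝ) (i j : Fin d) :
    (V * Matrix.diagonal s * V.transpose) i j = ∑ k, V i k * s k * V j k := by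
  rw [Matrix.mul_apply]
  simp [Matrix.mul_diagonal]

theorem exists_spectral_of_mem_indexSet {B : Matrix (Fin d) (Fin d) ℝ} (hB : B ∈ indexSet d) :
    ∃ (W : Matrix.orthogonalGroup (Fin d) ℝ) (s : Fin d → ℝ),
      B = (W : Matrix (Fin d) (Fin d) ℝ) * Matrix.diagonal s *
        (W : Matrix (Fin d) (Fin d) ℝ).transpose ∧
      (∀ i, 0 ≤ s i) ∧ ∑ i, s i ^ 2 = 1 ∧
      (Finset.univ.filter fun i => s i ≠ 0).card = B.rank := by
  obtain ⟨hpsd, hnorm⟩ := hB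
  have hH := hpsd.1
  have hspec := hH.spectral_theorem
  set s := hH.eigenvalues with hs
  have hBW : B = (hH.eigenvectorUnitary : Matrix (Fin d) (Fin d) ℝ) * Matrix.diagonal s *
      (hH.eigenvectorUnitary : Matrix (Fin d) (Fin d) ℝ).transpose := by
    conv_lhs => rw [hspec]
    rw [Unitary.conjStarAlgAut_apply]
    rfl
  refine ⟨hH.eigenvectorUnitary, s, hBW, hpsd.eigenvalues_nonneg, ?_, ?_⟩
  · set W := (hH.eigenvectorUnitary : Matrix (Fin d) (Fin d) ℝ) with hWdef
    have hWW : W.transpose * W = 1 := by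
      have := (Matrix.mem_orthogonalGroup_iff' (Fin d) ℝ).1 hH.eigenvectorUnitary.2
      exact this
    have h1 : ∑ i, ∑ j, B i j ^ 2 = 1 := by
      have h0 : 0 ≤ ∑ i, ∑ j, B i j ^ 2 := by positivity
      have := congrArg (· ^ 2) hnorm
      simpa [frobNorm, Real.sq_sqrt h0] using this
    have h2 : ∑ i, ∑ j, B i j ^ 2 = (B * B.transpose).trace := by
      simp [Matrix.trace, Matrix.mul_apply, sq]
    have h3 : B * B.transpose = W * Matrix.diagonal (fun i => s i ^ 2) * W.transpose := by
      conv_lhs => rw [hBW]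
      rw [Matrix.transpose_mul, Matrix.transpose_mul, Matrix.transpose_transpose,
        Matrix.diagonal_transpose]
      calc _ = W * Matrix.diagonal s * (W.transpose * W) * (Matrix.diagonal s * W.transpose) := by
            simp only [Matrix.mul_assoc]
        _ = W * (Matrix.diagonal s * Matrix.diagonal s) * W.transpose := by
            rw [hWW]; simp only [Matrix.mul_assoc, Matrix.mul_one]
        _ = _ := by rw [Matrix.diagonal_mul_diagonal]; simp only [sq]
    rw [← h1, h2, h3, Matrix.trace_mul_comm, ← Matrix.mul_assoc, hWW, Matrix.one_mul,
      Matrix.trace_diagonal]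
  · rw [hH.rank_eq_card_non_zero_eigs, Fintype.card_subtype]

theorem abs_sqrt_sub_le {x y : ℝ} (hy : 0 ≤ y) {η : ℝ} (h : |x - y ^ 2| ≤ η) :
    |√x - y| ≤ √η := by
  have hη : 0 ≤ η := (abs_nonneg _).trans h
  have h1 := abs_le.1 h
  have h2 := Real.sqrt_nonneg η
  have h3 := Real.sq_sqrt hη
  rw [abs_le, neg_le_sub_iff_le_add, sub_le_iff_le_add]
  constructor
  · have : y ^ 2 ≤ (√x + √η) ^ 2 := by
      rcases le_total 0 x with hx | hx
      · have h4 := Real.sq_sqrt hx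
        nlinarith [Real.sqrt_nonneg x, mul_nonneg (Real.sqrt_nonneg x) h2]
      · rw [Real.sqrt_eq_zero_of_nonpos hx]; nlinarith
    exact le_of_sq_le_sq this (by positivity)
  · rw [Real.sqrt_le_left (by positivity)]
    nlinarith [mul_nonneg h2 hy]

/-- A column with zero target eigenvalue contributes only through the small t k, whatever V is
there. So V has to approximate W on rank-many columns only, which is the source of the factor
rank(B⋆) · d. -/
theorem abs_conj_diagonal_sub_le {V W : Matrix.orthogonalGroup (Fin d) ℝ} {s t : Fin d → ℝ}
    (hs : ∀ i, |s i| ≤ 1) {a b : ℝ} (hb : 0 ≤ b) (hst : ∀ k, |t k - s k| ≤ a)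
    (hVW : ∀ k, s k ≠ 0 → ∀ i, |(V : Matrix (Fin d) (Fin d) ℝ) i k
      - (W : Matrix (Fin d) (Fin d) ℝ) i k| ≤ b) (i j : Fin d) :
    |((V : Matrix (Fin d) (Fin d) ℝ) * Matrix.diagonal t *
          (V : Matrix (Fin d) (Fin d) ℝ).transpose) i j
        - ((W : Matrix (Fin d) (Fin d) ℝ) * Matrix.diagonal s *
          (W : Matrix (Fin d) (Fin d) ℝ).transpose) i j| ≤ d * (a + 2 * b) := by
  rw [conj_diagonal_apply, conj_diagonal_apply, ← Finset.sum_sub_distrib]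
  refine (Finset.abs_sum_le_sum_abs _ _).trans ?_
  calc _ ≤ ∑ _k : Fin d, (a + 2 * b) := Finset.sum_le_sum fun k _ => ?_
    _ = _ := by rw [Finset.sum_const, Finset.card_univ, Fintype.card_fin, nsmul_eq_mul]
  have h1 := abs_orthogonal_le_one V i k
  have h2 := abs_orthogonal_le_one V j k
  have h3 := abs_orthogonal_le_one W i k
  have h5 : |(V : Matrix (Fin d) (Fin d) ℝ) i k * (t k - s k) *
      (V : Matrix (Fin d) (Fin d) ℝ) j k| ≤ a := by
    rw [abs_mul, abs_mul]
    calc _ ≤ 1 * |t k - s k| * 1 := by gcongr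
      _ ≤ a := by simpa using hst k
  by_cases hk : s k = 0
  · rw [hk, sub_zero] at h5
    rw [hk, mul_zero, zero_mul, sub_zero]
    linarith
  · have h6 := hVW k hk i
    have h7 := hVW k hk j
    have h8 : |((V : Matrix (Fin d) (Fin d) ℝ) i k - (W : Matrix (Fin d) (Fin d) ℝ) i k) * s k *
        (V : Matrix (Fin d) (Fin d) ℝ) j k| ≤ b := by
      rw [abs_mul, abs_mul]
      calc _ ≤ b * 1 * 1 := by have := hs k; gcongr
        _ = b := by ring
    have h9 : |(W : Matrix (Fin d) (Fin d) ℝ) i k * s k *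
        ((V : Matrix (Fin d) (Fin d) ℝ) j k - (W : Matrix (Fin d) (Fin d) ℝ) j k)| ≤ b := by
      rw [abs_mul, abs_mul]
      calc _ ≤ 1 * 1 * b := by have := hs k; gcongr
        _ = b := by ring
    calc _ = |(V : Matrix (Fin d) (Fin d) ℝ) i k * (t k - s k) *
          (V : Matrix (Fin d) (Fin d) ℝ) j k
        + ((V : Matrix (Fin d) (Fin d) ℝ) i k - (W : Matrix (Fin d) (Fin d) ℝ) i k) * s k *
          (V : Matrix (Fin d) (Fin d) ℝ) j k
        + (W : Matrix (Fin d) (Fin d) ℝ) i k * s k *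
        ((V : Matrix (Fin d) (Fin d) ℝ) j k - (W : Matrix (Fin d) (Fin d) ℝ) j k)| := by
          congr 1; ring
      _ ≤ a + b + b := (abs_add_three _ _ _).trans (by gcongr)
      _ = _ := by ring

theorem measurableSet_entrywise_ball (B : Matrix (Fin d) (Fin d) ℝ) (η : ℝ) :
    MeasurableSet {B' : Matrix (Fin d) (Fin d) ℝ | ∀ i j, |B' i j - B i j| ≤ η} := by
  refine IsClosed.measurableSet ?_
  simp only [Set.ofPred_forall]
  exact isClosed_iInter fun i => isClosed_iInter fun j =>
    isClosed_le (by fun_prop) continuous_const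

/-- The Frobenius normalization makes the squared eigenvalues a point of the simplex, which is the
target for γ. Taking square roots is only 1/2-Hölder at 0, whence the √(dh). -/
theorem le_priorB {α : Fin d → ℝ} (hα : ∀ i, 0 < α i) (hα1 : ∀ i, α i ≤ 1)
    {B : Matrix (Fin d) (Fin d) ℝ} (hB : B ∈ indexSet d) {m : ℕ} (hm : 1 ≤ m) {h : ℝ}
    (hh : 0 ≤ h) (hh1 : h ≤ 1) :
    ENNReal.ofReal ((1 / ((m : ℝ) + 1)) ^ (d * B.rank) * ∏ i, (h * α i / (2 * Real.exp 2)))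
      ≤ priorB α {B' | ∀ i j, |B' i j - B i j| ≤ d * (√(d * h) + 2 * (d * (2 / m)))} := by
  have := isProbabilityMeasure_dirichlet hα
  obtain ⟨W, s, hBW, hs0, hs1, hcard⟩ := exists_spectral_of_mem_indexSet hB
  have hsle : ∀ i, |s i| ≤ 1 := fun i => by
    rw [← abs_one, ← sq_le_sq, one_pow, ← hs1]
    exact Finset.single_le_sum (f := fun i => s i ^ 2) (fun j _ => sq_nonneg _) (Finset.mem_univ i)
  rw [ENNReal.ofReal_mul (by positivity), priorB,
    Measure.map_apply measurable_priorB_map (measurableSet_entrywise_ball _ _), ← hcard]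
  refine (mul_le_mul' (le_haarOrthogonal_columns (Finset.univ.filter fun i => s i ≠ 0) W hm)
    (le_dirichlet hα hα1 (c := fun i => s i ^ 2) (fun i => sq_nonneg _) hs1 hh hh1)).trans ?_
  rw [← Measure.prod_prod]
  refine measure_mono ?_
  rintro ⟨V, γ⟩ ⟨hV, hγ⟩ i j
  conv_lhs => rw [hBW]
  exact abs_conj_diagonal_sub_le hsle (by positivity)
    (fun k => abs_sqrt_sub_le (hs0 k) (hγ k))
    (fun k hk => hV k (Finset.mem_filter.2 ⟨Finset.mem_univ k, hk⟩)) i j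

end MatrixPrior

/-! ### Deviation of the Gibbs posterior in the single-index model -/

section Model

instance instSecondCountableTopologyMatrix (d : ℕ) :
    SecondCountableTopology (Matrix (Fin d) (Fin d) ℝ) :=
  inferInstanceAs (SecondCountableTopology (Fin d → Fin d → ℝ))

variable {d : ℕ}

theorem continuous_pairing :
    Continuous fun p : Matrix (Fin d) (Fin d) ℝ × Matrix (Fin d) (Fin d) ℝ => pairing p.1 p.2 := by
  unfold pairing
  fun_prop

theorem measurable_link_pairing : Measurable
    fun p : (Matrix (Fin d) (Fin d) ℝ × C(ℝ, ℝ)) × Matrix (Fin d) (Fin d) ℝ =>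
      p.1.2 (pairing p.2 p.1.1) := by
  have h1 : Measurable fun p : (Matrix (Fin d) (Fin d) ℝ × C(ℝ, ℝ)) × Matrix (Fin d) (Fin d) ℝ =>
      (p.1.2, pairing p.2 p.1.1) :=
    (measurable_snd.comp measurable_fst).prodMk
      (continuous_pairing.measurable.comp
        (measurable_snd.prodMk (measurable_fst.comp measurable_fst)))
  have h2 : Measurable fun q : C(ℝ, ℝ) × ℝ => q.1 q.2 :=
    Continuous.measurable (by fun_prop)
  exact h2.comp h1

theorem abs_pairing_sub_le {X B B' : Matrix (Fin d) (Fin d) ℝ} (hX : ∀ i j, |X i j| ≤ 1) {η : ℝ}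
    (hB : ∀ i j, |B' i j - B i j| ≤ η) : |pairing X B' - pairing X B| ≤ d * (d * η) := by
  unfold pairing
  rw [← Matrix.trace_sub, ← Matrix.mul_sub, Matrix.trace]
  refine (Finset.abs_sum_le_sum_abs _ _).trans ?_
  calc _ ≤ ∑ _i : Fin d, (d * η : ℝ) := Finset.sum_le_sum fun i _ => ?_
    _ = _ := by rw [Finset.sum_const, Finset.card_univ, Fintype.card_fin, nsmul_eq_mul]
  rw [Matrix.diag_apply, Matrix.mul_apply]
  refine (Finset.abs_sum_le_sum_abs _ _).trans ?_
  calc _ ≤ ∑ _j : Fin d, η := Finset.sum_le_sum fun j _ => ?_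
    _ = _ := by rw [Finset.sum_const, Finset.card_univ, Fintype.card_fin, nsmul_eq_mul]
  rw [abs_mul, Matrix.sub_apply]
  calc _ ≤ 1 * |B' j i - B j i| := by have := hX i j; gcongr
    _ ≤ η := by rw [one_mul]; exact hB j i

/-- This allows the empirical risk of the truth, which does not depend on θ, to be subtracted inside
the Gibbs density. -/
theorem tilted_add_const {Θ : Type*} [MeasurableSpace Θ] (π : Measure Θ) (f : Θ → ℝ) (c : ℝ) :
    π.tilted (fun θ => f θ + c) = π.tilted f := by
  unfold Measure.tilted
  congr 1
  ext θ
  congr 1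
  simp_rw [Real.exp_add]
  rw [integral_mul_const, mul_div_mul_right _ _ (Real.exp_pos c).ne']

/-- The excess risk of `(B, f)` in the model with index `B₀` and link `f₀`. -/
noncomputable def excess {Ω : Type*} [MeasurableSpace Ω] (μ : Measure Ω)
    (X : Ω → Matrix (Fin d) (Fin d) ℝ) (B₀ : Matrix (Fin d) (Fin d) ℝ) (f₀ : ℝ → ℝ)
    (θ : Matrix (Fin d) (Fin d) ℝ × C(ℝ, ℝ)) : ℝ :=
  ∫ ω, (f₀ (pairing (X ω) B₀) - θ.2 (pairing (X ω) θ.1)) ^ 2 ∂μ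

theorem stronglyMeasurable_residual {Ω : Type*}
    {X : Ω → Matrix (Fin d) (Fin d) ℝ} {B₀ : Matrix (Fin d) (Fin d) ℝ} {f₀ : ℝ → ℝ} (hf₀ : Measurable f₀)
    (θ : Matrix (Fin d) (Fin d) ℝ × C(ℝ, ℝ)) :
    StronglyMeasurable[MeasurableSpace.comap X inferInstance]
      fun ω => f₀ (pairing (X ω) B₀) - θ.2 (pairing (X ω) θ.1) := by
  have h1 : Measurable fun x : Matrix (Fin d) (Fin d) ℝ =>
      f₀ (pairing x B₀) - θ.2 (pairing x θ.1) :=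
    (hf₀.comp (continuous_pairing.measurable.comp (measurable_id.prodMk measurable_const))).sub
      (measurable_link_pairing.comp (measurable_const.prodMk measurable_id))
  exact (h1.comp (comap_measurable X)).stronglyMeasurable

theorem SubexpNoise.integrable_sq {Ω : Type*} [MeasurableSpace Ω] {μ : Measure Ω}
    {X : Ω → Matrix (Fin d) (Fin d) ℝ} {ε : Ω → ℝ} {σ L : ℝ} (hN : SubexpNoise μ X ε σ L) :
    Integrable (fun ω => ε ω ^ 2) μ := by
  simpa only [sq_abs] using (hN 2 le_rfl).1

theorem integral_sq_comp_le {Ω : Type*} [MeasurableSpace Ω] {μ : Measure Ω} {Z : Ω → ℝ}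
    (hZ : Measurable Z) {A : ℝ} (hD : HasBoundedDensity μ Z A)
    (hA : 0 ≤ A) {u : ℝ → ℝ} (hu : Measurable u) {q : ℝ} (hq : 0 ≤ q)
    (h : ∫⁻ t in Set.Icc (-1 : ℝ) 1, ENNReal.ofReal (u t ^ 2) ≤ ENNReal.ofReal q) :
    ∫ ω, u (Z ω) ^ 2 ∂μ ≤ A * q := by
  obtain ⟨p, hp, hpA, hmap⟩ := hD
  have hm : Measurable fun ω => u (Z ω) ^ 2 := (hu.comp hZ).pow_const 2
  rw [integral_eq_lintegral_of_nonneg_ae (ae_of_all _ fun _ => sq_nonneg _)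
    hm.aestronglyMeasurable]
  refine ENNReal.toReal_le_of_le_ofReal (by positivity) ?_
  have mu2 : Measurable fun t => ENNReal.ofReal (u t ^ 2) := (hu.pow_const 2).ennreal_ofReal
  calc ∫⁻ ω, ENNReal.ofReal (u (Z ω) ^ 2) ∂μ
      = ∫⁻ t, ENNReal.ofReal (u t ^ 2) ∂(μ.map Z) := (lintegral_map mu2 hZ).symm
    _ = ∫⁻ t in Set.Icc (-1 : ℝ) 1, p t * ENNReal.ofReal (u t ^ 2) := by
        rw [hmap, lintegral_withDensity_eq_lintegral_mul _ hp mu2]; rfl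
    _ ≤ ∫⁻ t in Set.Icc (-1 : ℝ) 1, ENNReal.ofReal A * ENNReal.ofReal (u t ^ 2) :=
        lintegral_mono fun t => mul_le_mul_left (hpA t) _
    _ = ENNReal.ofReal A * ∫⁻ t in Set.Icc (-1 : ℝ) 1, ENNReal.ofReal (u t ^ 2) :=
        lintegral_const_mul _ mu2
    _ ≤ ENNReal.ofReal A * ENNReal.ofReal q := by gcongr
    _ = _ := (ENNReal.ofReal_mul hA).symm

variable {Ω : Type*} [MeasurableSpace Ω] {μ : Measure Ω} [IsProbabilityMeasure μ]
  {X : Ω → Matrix (Fin d) (Fin d) ℝ} {Y ε : Ω → ℝ} {B₀ : Matrix (Fin d) (Fin d) ℝ} {f₀ : ℝ → ℝ}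

theorem measurable_excess (hX : Measurable X) (hf₀ : Measurable f₀) :
    Measurable (excess μ X B₀ f₀) := by
  have h1 : Measurable fun p : (Matrix (Fin d) (Fin d) ℝ × C(ℝ, ℝ)) × Ω =>
      p.1.2 (pairing (X p.2) p.1.1) :=
    measurable_link_pairing.comp (measurable_fst.prodMk (hX.comp measurable_snd))
  have h2 : Measurable fun p : (Matrix (Fin d) (Fin d) ℝ × C(ℝ, ℝ)) × Ω =>
      f₀ (pairing (X p.2) B₀) :=
    hf₀.comp (continuous_pairing.measurable.comp
      ((hX.comp measurable_snd).prodMk measurable_const))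
  exact (((h2.sub h1).pow_const 2).stronglyMeasurable.integral_prod_right).measurable

theorem SubexpNoise.integrable {σ L : ℝ} (hN : SubexpNoise μ X ε σ L) (hε : Measurable ε) :
    Integrable ε μ :=
  ((memLp_two_iff_integrable_sq hε.aestronglyMeasurable).2 hN.integrable_sq).integrable
    (by norm_num)

theorem risk_sub_risk_eq_excess (hX : Measurable X) (hε : Measurable ε) (hf₀ : Measurable f₀)
    (hmodel : ∀ᵐ ω ∂μ, Y ω = f₀ (pairing (X ω) B₀) + ε ω)
    (hmean : μ[ε | MeasurableSpace.comap X inferInstance] =ᵐ[μ] 0) {σ L : ℝ}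
    (hN : SubexpNoise μ X ε σ L) {K : ℝ} (hf₀K : ∀ t, |f₀ t| ≤ K)
    {θ : Matrix (Fin d) (Fin d) ℝ × C(ℝ, ℝ)} (hθ : ∀ t, |θ.2 t| ≤ K) :
    risk μ X Y θ.1 θ.2 - risk μ X Y B₀ f₀ = excess μ X B₀ f₀ θ := by
  have hm : MeasurableSpace.comap X inferInstance ≤ (inferInstance : MeasurableSpace Ω) :=
    hX.comap_le
  set g : Ω → ℝ := fun ω => f₀ (pairing (X ω) B₀) - θ.2 (pairing (X ω) θ.1) with hg
  have hgm : StronglyMeasurable[MeasurableSpace.comap X inferInstance] g :=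
    stronglyMeasurable_residual hf₀ θ
  have hgK : ∀ ω, |g ω| ≤ 2 * K := fun ω => by
    have h1 := hf₀K (pairing (X ω) B₀)
    have h2 := hθ (pairing (X ω) θ.1)
    exact (abs_sub _ _).trans (by linarith)
  have hε1 := hN.integrable hε
  have hε2 := hN.integrable_sq
  have hgi : Integrable (fun ω => g ω * ε ω) μ := integrable_mul_of_bdd hm hgm hgK hε1
  have hg2 : Integrable (fun ω => g ω ^ 2) μ :=
    integrable_of_bdd hm (hgm.pow 2) (K := (2 * K) ^ 2) fun ω => by
      rw [abs_pow]; have := hgK ω; gcongr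
  have hzero : ∫ ω, g ω * ε ω ∂μ = 0 := by
    rw [integral_mul_eq_integral_mul_condExp hm hgm hgK hε1]
    refine integral_eq_zero_of_ae ?_
    filter_upwards [hmean] with ω hω
    simp [hω]
  have h1 : risk μ X Y θ.1 θ.2 = ∫ ω, ((ε ω ^ 2 + 2 * (g ω * ε ω)) + g ω ^ 2) ∂μ := by
    refine integral_congr_ae ?_
    filter_upwards [hmodel] with ω hω
    rw [hω, hg]; ring
  have h2 : risk μ X Y B₀ f₀ = ∫ ω, ε ω ^ 2 ∂μ := by
    refine integral_congr_ae ?_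
    filter_upwards [hmodel] with ω hω
    rw [hω]; ring
  have h3 : Integrable (fun ω => ε ω ^ 2 + 2 * (g ω * ε ω)) μ := hε2.add (hgi.const_mul 2)
  rw [h1, h2, integral_add h3 hg2, integral_add hε2 (hgi.const_mul 2), integral_const_mul, hzero]
  simp [excess, hg]

/-- The loss of a single observation relative to the reference pair `(B₀, f₀)`. -/
noncomputable def relLoss (B₀ : Matrix (Fin d) (Fin d) ℝ) (f₀ : ℝ → ℝ)
    (θ : Matrix (Fin d) (Fin d) ℝ × C(ℝ, ℝ)) (z : Matrix (Fin d) (Fin d) ℝ × ℝ) : ℝ :=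
  (z.2 - θ.2 (pairing z.1 θ.1)) ^ 2 - (z.2 - f₀ (pairing z.1 B₀)) ^ 2

theorem measurable_relLoss (hf₀ : Measurable f₀) :
    Measurable (Function.uncurry (relLoss B₀ f₀)) := by
  have h3 : Measurable
      (fun p => p.2.2 :
        (Matrix (Fin d) (Fin d) ℝ × C(ℝ, ℝ)) × (Matrix (Fin d) (Fin d) ℝ × ℝ) → ℝ) :=
    measurable_snd.comp measurable_snd
  have h4 : Measurable
      (fun p => p.2.1 : (Matrix (Fin d) (Fin d) ℝ × C(ℝ, ℝ)) ×
        (Matrix (Fin d) (Fin d) ℝ × ℝ) → Matrix (Fin d) (Fin d) ℝ) :=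
    measurable_fst.comp measurable_snd
  have h1 := measurable_link_pairing.comp (measurable_fst.prodMk h4)
  have h2 := hf₀.comp (continuous_pairing.measurable.comp
    (h4.prodMk (measurable_const (a := B₀))))
  exact ((h3.sub h1).pow_const 2).sub ((h3.sub h2).pow_const 2)

theorem lintegral_exp_relLoss_le (hX : Measurable X) (hY : Measurable Y) (hε : Measurable ε)
    (hf₀ : Measurable f₀) (hmodel : ∀ᵐ ω ∂μ, Y ω = f₀ (pairing (X ω) B₀) + ε ω)
    (hmean : μ[ε | MeasurableSpace.comap X inferInstance] =ᵐ[μ] 0) {σ L : ℝ} (hL : 0 < L)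
    (hN : SubexpNoise μ X ε σ L) {K s : ℝ} (hs : 0 < s) (hsL : 64 * K * L * s ≤ 1)
    (hsK : 64 * K * K * s ≤ 1) (hsσ : 16 * σ ^ 2 * s ≤ 1) (hf₀K : ∀ t, |f₀ t| ≤ K)
    {θ : Matrix (Fin d) (Fin d) ℝ × C(ℝ, ℝ)} (hθ : ∀ t, |θ.2 t| ≤ K) (n : ℕ) :
    ∫⁻ D, ENNReal.ofReal (Real.exp (-∑ i, s * relLoss B₀ f₀ θ (D i))) ∂(sampleLaw μ n X Y)
        ≤ ENNReal.ofReal (Real.exp (-(n * s / 2 * excess μ X B₀ f₀ θ))) ∧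
      ∫⁻ D, ENNReal.ofReal (Real.exp (∑ i, s * relLoss B₀ f₀ θ (D i))) ∂(sampleLaw μ n X Y)
        ≤ ENNReal.ofReal (Real.exp (4 * (n * s / 2) * excess μ X B₀ f₀ θ)) := by
  have hm : MeasurableSpace.comap X inferInstance ≤ (inferInstance : MeasurableSpace Ω) :=
    hX.comap_le
  set g : Ω → ℝ := fun ω => f₀ (pairing (X ω) B₀) - θ.2 (pairing (X ω) θ.1) with hg
  have hgm : StronglyMeasurable[MeasurableSpace.comap X inferInstance] g :=
    stronglyMeasurable_residual hf₀ θ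
  have hgK : ∀ ω, |g ω| ≤ 2 * K := fun ω => by
    have h1 := hf₀K (pairing (X ω) B₀)
    have h2 := hθ (pairing (X ω) θ.1)
    exact (abs_sub _ _).trans (by linarith)
  obtain ⟨hlow, hup⟩ := lintegral_exp_excess_le (μ := μ) hm hgm hgK hL hs hsL hsK hsσ hε hmean hN
    (hN.integrable hε)
  have hXY : Measurable fun ω => (X ω, Y ω) := hX.prodMk hY
  have : IsProbabilityMeasure (μ.map fun ω => (X ω, Y ω)) :=
    Measure.isProbabilityMeasure_map hXY.aemeasurable
  have mrel : Measurable (relLoss B₀ f₀ θ) :=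
    (measurable_relLoss hf₀).comp (measurable_const.prodMk measurable_id)
  have hrel : ∀ᵐ ω ∂μ, relLoss B₀ f₀ θ (X ω, Y ω) = 2 * ε ω * g ω + g ω ^ 2 := by
    filter_upwards [hmodel] with ω hω
    simp only [relLoss, hω, hg]; ring
  have key : ∀ c : ℝ, ∫⁻ D, ENNReal.ofReal (Real.exp (∑ i, c * relLoss B₀ f₀ θ (D i)))
      ∂(sampleLaw μ n X Y)
      = (∫⁻ ω, ENNReal.ofReal (Real.exp (c * (2 * ε ω * g ω + g ω ^ 2))) ∂μ) ^ n := by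
    intro c
    rw [sampleLaw, lintegral_pi_exp_sum _ (mrel.const_mul c), lintegral_map (by fun_prop) hXY]
    congr 1
    refine lintegral_congr_ae ?_
    filter_upwards [hrel] with ω hω
    rw [hω]
  have hneg : ∀ D : Fin n → Matrix (Fin d) (Fin d) ℝ × ℝ, -∑ i, s * relLoss B₀ f₀ θ (D i)
      = ∑ i, (-s) * relLoss B₀ f₀ θ (D i) := fun D => by
    rw [← Finset.sum_neg_distrib]; simp only [neg_mul]
  constructor
  · simp_rw [hneg, key, neg_mul]
    refine (pow_le_pow_left' hlow n).trans (le_of_eq ?_)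
    rw [← ENNReal.ofReal_pow (Real.exp_pos _).le, ← Real.exp_nat_mul]
    congr 2
    simp only [excess, hg]; ring
  · rw [key]
    refine (pow_le_pow_left' hup n).trans (le_of_eq ?_)
    rw [← ENNReal.ofReal_pow (Real.exp_pos _).le, ← Real.exp_nat_mul]
    congr 2
    simp only [excess, hg]; ring

theorem gibbs_eq_tilted {n : ℕ} (α : Fin d → ℝ) (Λ lam : ℝ)
    (D : Fin n → Matrix (Fin d) (Fin d) ℝ × ℝ) (B₀ : Matrix (Fin d) (Fin d) ℝ) (f₀ : ℝ → ℝ) :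
    gibbs α Λ lam D
      = (prior n α Λ).tilted fun θ => -∑ i, lam / n * relLoss B₀ f₀ θ (D i) := by
  rw [gibbs, ← tilted_add_const _ _ (lam * empRisk D B₀ f₀)]
  congr 1
  ext θ
  simp only [empRisk, relLoss]
  rw [← Finset.mul_sum, Finset.sum_sub_distrib]
  ring

/-- The deviation bound for the Gibbs posterior: a set of prior mass at least `exp (-κ)` on which
the excess risk is at most `E₀` controls the excess risk of a draw from the posterior. -/
theorem gibbs_excess_bound {n : ℕ} (hn : 1 ≤ n) {α : Fin d → ℝ} (hα : ∀ i, 0 < α i) {K : ℝ}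
    (hK : 0 < K) (hX : Measurable X) (hY : Measurable Y) (hε : Measurable ε)
    (hf₀ : Measurable f₀) (hmodel : ∀ᵐ ω ∂μ, Y ω = f₀ (pairing (X ω) B₀) + ε ω)
    (hmean : μ[ε | MeasurableSpace.comap X inferInstance] =ᵐ[μ] 0) {σ L : ℝ} (hL : 0 < L)
    (hN : SubexpNoise μ X ε σ L) {lam : ℝ} (hlam : 0 < lam)
    (hsL : 64 * K * L * (lam / n) ≤ 1) (hsK : 64 * K * K * (lam / n) ≤ 1)
    (hsσ : 16 * σ ^ 2 * (lam / n) ≤ 1) (hf₀K : ∀ t, |f₀ t| ≤ K)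
    {T : Set (Matrix (Fin d) (Fin d) ℝ × C(ℝ, ℝ))} (hT : MeasurableSet T) {E₀ κ : ℝ}
    (hTE : ∀ θ ∈ T, excess μ X B₀ f₀ θ ≤ E₀)
    (hκ : ENNReal.ofReal (Real.exp (-κ)) ≤ prior n α K T) {δ : ℝ} (hδ : 0 < δ) {b : ℝ}
    (hb : 2 * lam * E₀ + κ + 2 * Real.log (2 / δ) ≤ lam / 2 * b) :
    ENNReal.ofReal (1 - δ) ≤ ∫⁻ D, gibbs α K lam D
      {θ | risk μ X Y θ.1 θ.2 - risk μ X Y B₀ f₀ ≤ b} ∂(sampleLaw μ n X Y) := by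
  have hn0 : (0 : ℝ) < n := by exact_mod_cast hn
  have := isProbabilityMeasure_priorB hα
  have := isProbabilityMeasure_priorF hn hK
  have : IsProbabilityMeasure (prior n α K) := by unfold prior; infer_instance
  have hXY : Measurable fun ω => (X ω, Y ω) := hX.prodMk hY
  have : IsProbabilityMeasure (μ.map fun ω => (X ω, Y ω)) :=
    Measure.isProbabilityMeasure_map hXY.aemeasurable
  have : IsProbabilityMeasure (sampleLaw μ n X Y) := by unfold sampleLaw; infer_instance
  have hgood : ∀ᵐ θ ∂(prior n α K), ∀ t, |θ.2 t| ≤ K := by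
    have h1 : ∀ᵐ θ ∂((priorB α).prod (priorF n K)), θ.2 ∈ tameLinks K :=
      Measure.quasiMeasurePreserving_snd.ae (priorF_tameLinks n K)
    filter_upwards [h1] with θ hθ using hθ.1
  set s := lam / n with hs_def
  have hs : 0 < s := by positivity
  have hns : n * s / 2 = lam / 2 := by rw [hs_def]; field_simp
  set ℓ : (Fin n → Matrix (Fin d) (Fin d) ℝ × ℝ) → Matrix (Fin d) (Fin d) ℝ × C(ℝ, ℝ) → ℝ :=
    fun D θ => ∑ i, s * relLoss B₀ f₀ θ (D i) with hℓ
  have mℓ : Measurable (Function.uncurry ℓ) := by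
    refine Finset.measurable_sum _ fun i _ => Measurable.const_mul ?_ s
    exact (measurable_relLoss hf₀).comp
      (measurable_snd.prodMk ((measurable_pi_apply i).comp measurable_fst))
  -- Dropping the nonnegative square of the candidate leaves a bound that is independent of θ.
  have hint : ∀ D, Integrable (fun θ => Real.exp (-ℓ D θ)) (prior n α K) := by
    intro D
    refine Integrable.of_bound
      (Real.measurable_exp.comp (mℓ.of_uncurry_left (x := D)).neg).aestronglyMeasurable
      (Real.exp (∑ i, s * ((D i).2 - f₀ (pairing (D i).1 B₀)) ^ 2)) (ae_of_all _ fun θ => ?_)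
    rw [Real.norm_eq_abs, Real.abs_exp]
    refine Real.exp_le_exp.2 ?_
    simp only [hℓ]
    rw [← Finset.sum_neg_distrib]
    refine Finset.sum_le_sum fun i _ => ?_
    rw [← mul_neg]
    refine mul_le_mul_of_nonneg_left ?_ hs.le
    simp only [relLoss, neg_sub]
    linarith [sq_nonneg ((D i).2 - θ.2 (pairing (D i).1 θ.1))]
  have hdev := gibbs_deviation (sampleLaw μ n X Y) (prior n α K) ℓ mℓ hint
    (excess μ X B₀ f₀) (measurable_excess hX hf₀) (c := lam / 2) (by positivity)
    (by
      filter_upwards [hgood] with θ hθ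
      rw [← hns]
      exact (lintegral_exp_relLoss_le hX hY hε hf₀ hmodel hmean hL hN hs hsL hsK hsσ hf₀K hθ n).1)
    (by
      filter_upwards [hgood] with θ hθ
      rw [← hns]
      exact (lintegral_exp_relLoss_le hX hY hε hf₀ hmodel hmean hL hN hs hsL hsK hsσ hf₀K hθ n).2)
    hT hTE hκ hδ (b := b) (by linarith)
  refine hdev.trans (lintegral_mono fun D => ?_)
  show (prior n α K).tilted (fun θ => -ℓ D θ) _ ≤ _
  rw [gibbs_eq_tilted α K lam D B₀ f₀]
  refine measure_mono_ae ?_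
  -- The identity between excess and risk difference is available for bounded links, which carry the
  -- posterior since it is absolutely continuous with respect to the prior.
  filter_upwards [(tilted_absolutelyContinuous _ _).ae_le hgood] with θ hθ hθb
  show risk μ X Y θ.1 θ.2 - risk μ X Y B₀ f₀ ≤ b
  rw [risk_sub_risk_eq_excess hX hε hf₀ hmodel hmean hN hf₀K hθ]
  exact hθb

/-- Three errors: replacing f₀ by S at the true index, replacing S by f at the true index, and
changing the index inside f. Only the first needs the density bound, and only for ⟨X, B₀⟩; the last
uses that f is Lipschitz, so no density is needed for ⟨X, B⟩. -/
theorem excess_le_of_near (hX : Measurable X) (hf₀ : Measurable f₀)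
    (hBX : ∀ᵐ ω ∂μ, ∀ i j, |X ω i j| ≤ 1) {A : ℝ} (hA : 0 ≤ A)
    (hD : HasBoundedDensity μ (fun ω => pairing (X ω) B₀) A) {K : ℝ} (hf₀K : ∀ t, |f₀ t| ≤ K)
    {S : C(ℝ, ℝ)} (hS : ∀ t, |S t| ≤ K) {q : ℝ} (hq : 0 ≤ q)
    (h : ∫⁻ t in Set.Icc (-1 : ℝ) 1, ENNReal.ofReal ((f₀ t - S t) ^ 2) ≤ ENNReal.ofReal q)
    {θ : Matrix (Fin d) (Fin d) ℝ × C(ℝ, ℝ)} {η t₀ : ℝ} (hη : ∀ i j, |θ.1 i j - B₀ i j| ≤ η)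
    (ht : ∀ t, |θ.2 t - S t| ≤ t₀) (hθ : θ.2 ∈ tameLinks K) :
    excess μ X B₀ f₀ θ ≤ 3 * (A * q) + 3 * t₀ ^ 2 + 3 * (Real.pi * K * (d * (d * η))) ^ 2 := by
  have hK : 0 ≤ K := (abs_nonneg _).trans (hf₀K 0)
  have mZ : Measurable fun ω => pairing (X ω) B₀ :=
    continuous_pairing.measurable.comp (hX.prodMk measurable_const)
  have mu : Measurable fun t => f₀ t - S t := hf₀.sub S.continuous.measurable
  have hu := integral_sq_comp_le mZ hD hA mu hq h
  have hui : Integrable (fun ω => (f₀ (pairing (X ω) B₀) - S (pairing (X ω) B₀)) ^ 2) μ := by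
    refine Integrable.of_bound ((mu.comp mZ).pow_const 2).aestronglyMeasurable ((2 * K) ^ 2)
      (ae_of_all _ fun ω => ?_)
    rw [Real.norm_eq_abs, abs_pow]
    have h1 := hf₀K (pairing (X ω) B₀)
    have h2 := hS (pairing (X ω) B₀)
    have h3 := (abs_sub (f₀ (pairing (X ω) B₀)) (S (pairing (X ω) B₀))).trans (add_le_add h1 h2)
    gcongr
    linarith
  calc excess μ X B₀ f₀ θ
      ≤ ∫ ω, (3 * (f₀ (pairing (X ω) B₀) - S (pairing (X ω) B₀)) ^ 2
        + (3 * t₀ ^ 2 + 3 * (Real.pi * K * (d * (d * η))) ^ 2)) ∂μ := by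
        refine integral_mono_of_nonneg (ae_of_all _ fun _ => sq_nonneg _)
          ((hui.const_mul 3).add (integrable_const _)) ?_
        filter_upwards [hBX] with ω hω
        have h1 : |S (pairing (X ω) B₀) - θ.2 (pairing (X ω) B₀)| ≤ t₀ := by
          rw [abs_sub_comm]; exact ht _
        have h2 : |θ.2 (pairing (X ω) B₀) - θ.2 (pairing (X ω) θ.1)|
            ≤ Real.pi * K * (d * (d * η)) := by
          rw [abs_sub_comm]
          refine (hθ.2 _ _).trans ?_
          have := abs_pairing_sub_le hω hη
          gcongr
        have h1' := sq_le_sq' (abs_le.1 h1).1 (abs_le.1 h1).2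
        have h2' := sq_le_sq' (abs_le.1 h2).1 (abs_le.1 h2).2
        set x := f₀ (pairing (X ω) B₀) - S (pairing (X ω) B₀)
        set y := S (pairing (X ω) B₀) - θ.2 (pairing (X ω) B₀)
        set z := θ.2 (pairing (X ω) B₀) - θ.2 (pairing (X ω) θ.1)
        have e : f₀ (pairing (X ω) B₀) - θ.2 (pairing (X ω) θ.1) = x + y + z := by
          simp only [x, y, z]; ring
        show (f₀ (pairing (X ω) B₀) - θ.2 (pairing (X ω) θ.1)) ^ 2 ≤ _
        rw [e]
        nlinarith [sq_nonneg (x - y), sq_nonneg (x - z), sq_nonneg (y - z)]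
    _ = 3 * (∫ ω, (f₀ (pairing (X ω) B₀) - S (pairing (X ω) B₀)) ^ 2 ∂μ)
        + (3 * t₀ ^ 2 + 3 * (Real.pi * K * (d * (d * η))) ^ 2) := by
        rw [integral_add (hui.const_mul 3) (integrable_const _), integral_const_mul]; simp
    _ ≤ _ := by linarith

end Model

/-! ### Prior mass of a neighbourhood of the truth and choice of the truncation level -/

section Rates

variable {d : ℕ}

theorem one_le_log_sixteen_mul {n : ℕ} (hn : 1 ≤ n) : 1 ≤ Real.log (16 * n) := by
  have hn' : (1 : ℝ) ≤ n := by exact_mod_cast hn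
  rw [Real.le_log_iff_exp_le (by positivity)]
  have := Real.exp_one_lt_d9
  linarith

theorem one_le_rank_of_mem_indexSet {B : Matrix (Fin d) (Fin d) ℝ} (hB : B ∈ indexSet d) :
    1 ≤ B.rank := by
  obtain ⟨_, s, -, -, hs, hcard⟩ := exists_spectral_of_mem_indexSet hB
  rw [← hcard, Nat.one_le_iff_ne_zero, Ne, Finset.card_eq_zero, Finset.filter_eq_empty_iff]
  intro h
  have h0 : ∀ i, s i = 0 := fun i => not_not.1 (h (Finset.mem_univ i))
  simp [h0] at hs

/-- The 5 comes from the mesh m = n⁵ for the eigenvectors; the 10 is 9 + 1, from h = n⁻⁹ and αᵢ ≥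
D₁/n. The 1 inside the logarithm keeps it nonnegative, so it can be multiplied by log(16n) ≥ 1. -/
theorem exp_neg_le_matrix_mass {n : ℕ} (hn : 1 ≤ n) (hdn : d ≤ n) {D₁ : ℝ} (hD₁ : 0 < D₁)
    {α : Fin d → ℝ} (hα : ∀ i, D₁ / d ≤ α i) (r : ℕ) :
    Real.exp (-((5 * r + 10 + Real.log (1 + 2 * Real.exp 2 / D₁)) * d * Real.log (16 * n)))
      ≤ (1 / (((n ^ 5 : ℕ) : ℝ) + 1)) ^ (d * r)
        * ∏ i, ((1 / (n : ℝ) ^ 9) * α i / (2 * Real.exp 2)) := by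
  have hn1 : (1 : ℝ) ≤ n := by exact_mod_cast hn
  have hn0 : (0 : ℝ) < n := by linarith
  have hlog := one_le_log_sixteen_mul hn
  set ℓ := Real.log (16 * n) with hℓ
  set P := Real.log (1 + 2 * Real.exp 2 / D₁) with hP
  have hP0 : 0 ≤ P := Real.log_nonneg (by
    have : 0 < 2 * Real.exp 2 / D₁ := by positivity
    linarith)
  have hexp : Real.exp ℓ = 16 * n := Real.exp_log (by positivity)
  have hexpP : Real.exp P = 1 + 2 * Real.exp 2 / D₁ := Real.exp_log (by positivity)
  have h1 : Real.exp (-(5 * ℓ)) ≤ 1 / (((n ^ 5 : ℕ) : ℝ) + 1) := by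
    rw [Real.exp_neg, ← one_div]
    refine one_div_le_one_div_of_le (by positivity) ?_
    rw [show Real.exp (5 * ℓ) = (16 * (n : ℝ)) ^ 5 by
      rw [← hexp, ← Real.exp_nat_mul]; norm_num]
    push_cast
    have : (1 : ℝ) ≤ (n : ℝ) ^ 5 := one_le_pow₀ hn1
    rw [mul_pow]
    nlinarith
  have h2 : ∀ i, Real.exp (-((10 + P) * ℓ)) ≤ (1 / (n : ℝ) ^ 9) * α i / (2 * Real.exp 2) := by
    intro i
    have hd0 : (0 : ℝ) < d := by exact_mod_cast i.pos
    have hdn' : (d : ℝ) ≤ n := by exact_mod_cast hdn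
    calc Real.exp (-((10 + P) * ℓ)) ≤ Real.exp (-(10 * ℓ + P)) := by
          apply Real.exp_le_exp.2; nlinarith
      _ = 1 / ((16 * n) ^ 10 * (1 + 2 * Real.exp 2 / D₁)) := by
          rw [Real.exp_neg, Real.exp_add, hexpP, ← hexp, ← Real.exp_nat_mul, one_div]
          norm_num
      _ ≤ 1 / ((n : ℝ) ^ 10 * (2 * Real.exp 2 / D₁)) := by
          apply one_div_le_one_div_of_le (by positivity)
          have h16 : (n : ℝ) ≤ 16 * n := by linarith
          have he : 2 * Real.exp 2 / D₁ ≤ 1 + 2 * Real.exp 2 / D₁ := by linarith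
          exact mul_le_mul (pow_le_pow_left₀ hn0.le h16 10) he (by positivity) (by positivity)
      _ = (1 / (n : ℝ) ^ 9) * (D₁ / n) / (2 * Real.exp 2) := by field_simp
      _ ≤ _ := by
          have : D₁ / n ≤ α i := le_trans (by gcongr) (hα i)
          gcongr
  calc _ = Real.exp (-(5 * ℓ)) ^ (d * r) * ∏ _i : Fin d, Real.exp (-((10 + P) * ℓ)) := by
        rw [Finset.prod_const, Finset.card_univ, Fintype.card_fin, ← Real.exp_nat_mul,
          ← Real.exp_nat_mul, ← Real.exp_add]
        congr 1
        push_cast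
        ring
    _ ≤ _ := by
        refine mul_le_mul (pow_le_pow_left₀ (Real.exp_pos _).le h1 _)
          (Finset.prod_le_prod (fun _ _ => (Real.exp_pos _).le) fun i _ => h2 i)
          (Finset.prod_nonneg fun _ _ => (Real.exp_pos _).le) (by positivity)

/-- The powers n⁹ and n⁵ are chosen here: each error is of order n⁻⁴, the three factors d ≤ n cost
n³, and 1/n remains for the index error. -/
theorem entry_radius_le {n : ℕ} (hn : 1 ≤ n) (hdn : d ≤ n) :
    (d : ℝ) * (d * (d * (√(d * (1 / (n : ℝ) ^ 9)) + 2 * (d * (2 / ((n ^ 5 : ℕ) : ℝ))))))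
      ≤ 5 / n := by
  have hn1 : (1 : ℝ) ≤ n := by exact_mod_cast hn
  have hn0 : (0 : ℝ) < n := by linarith
  have hdn' : (d : ℝ) ≤ n := by exact_mod_cast hdn
  have h1 : √(d * (1 / (n : ℝ) ^ 9)) ≤ 1 / (n : ℝ) ^ 4 := by
    rw [Real.sqrt_le_left (by positivity)]
    calc (d : ℝ) * (1 / (n : ℝ) ^ 9) ≤ n * (1 / (n : ℝ) ^ 9) := by gcongr
      _ = (1 / (n : ℝ) ^ 4) ^ 2 := by field_simp
  have h2 : 2 * ((d : ℝ) * (2 / ((n ^ 5 : ℕ) : ℝ))) ≤ 4 / (n : ℝ) ^ 4 := by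
    push_cast
    calc _ ≤ 2 * ((n : ℝ) * (2 / (n : ℝ) ^ 5)) := by gcongr
      _ = _ := by field_simp; norm_num
  calc _ ≤ (n : ℝ) * (n * (n * (1 / (n : ℝ) ^ 4 + 4 / (n : ℝ) ^ 4))) := by gcongr
    _ = _ := by field_simp; norm_num

/-- A truncation level that balances the approximation error and the complexity. -/
theorem exists_truncation {n : ℕ} {C k : ℝ} (hC : 1 ≤ C) (hk : 0 < k) (hn : 3 ≤ n)
    (hlog : Real.log (C * n) ≤ n) :
    ∃ M : ℕ, 1 ≤ M ∧ M ≤ n ∧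
      ((M : ℝ) + 1) ^ (-(2 * k)) ≤ (Real.log (C * n) / n) ^ (2 * k / (2 * k + 1)) ∧
      M * Real.log (10 * (C + 1) * n)
        ≤ 4 * (n * (Real.log (C * n) / n) ^ (2 * k / (2 * k + 1))) := by
  have hn3 : (3 : ℝ) ≤ n := by exact_mod_cast hn
  have hn0 : (0 : ℝ) < n := by linarith
  have hCn : 3 ≤ C * n := by nlinarith
  have hℓ1 : 1 ≤ Real.log (C * n) := by
    rw [Real.le_log_iff_exp_le (by linarith)]
    have := Real.exp_one_lt_d9
    linarith
  have hlog10 : Real.log (10 * (C + 1) * n) ≤ 4 * Real.log (C * n) := by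
    have h4 : 4 * Real.log (C * n) = Real.log ((C * n) ^ 4) := by rw [Real.log_pow]; norm_num
    rw [h4]
    apply Real.log_le_log (by positivity)
    have h27 : (27 : ℝ) ≤ (C * n) ^ 3 := by
      calc (27 : ℝ) = 3 ^ 3 := by norm_num
        _ ≤ _ := by gcongr
    have : (C * n) ^ 4 = (C * n) ^ 3 * (C * n) := by ring
    nlinarith
  set ℓ := Real.log (C * n) with hℓ
  have hℓ0 : 0 < ℓ := by linarith
  -- Solves x^(-2k) = xℓ/n, the balance of bias and complexity; the floor of x is the level, and the
  -- bias is evaluated at M + 1 > x.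
  set x := ((n : ℝ) / ℓ) ^ (1 / (2 * k + 1)) with hx
  have hbase : 1 ≤ (n : ℝ) / ℓ := by rwa [one_le_div hℓ0]
  have hx1 : 1 ≤ x := Real.one_le_rpow hbase (by positivity)
  have hx0 : 0 < x := by linarith
  have hxn : x ≤ n := by
    calc x ≤ ((n : ℝ) / ℓ) ^ (1 : ℝ) :=
          Real.rpow_le_rpow_of_exponent_le hbase (by
            rw [div_le_one (by positivity)]; linarith)
      _ = n / ℓ := Real.rpow_one _
      _ ≤ n := div_le_self hn0.le hℓ1
  have hxr : x ^ (-(2 * k)) = (ℓ / n) ^ (2 * k / (2 * k + 1)) := by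
    rw [hx, ← Real.rpow_mul (by positivity), ← inv_div, Real.inv_rpow (by positivity),
      ← Real.rpow_neg (by positivity)]
    congr 1
    rw [mul_neg, one_div_mul_eq_div, neg_neg]
  have hxℓ : x * ℓ = n * (ℓ / n) ^ (2 * k / (2 * k + 1)) := by
    have h1 : x = (ℓ / n) ^ (-(1 / (2 * k + 1))) := by
      rw [hx, ← inv_div, Real.inv_rpow (by positivity), ← Real.rpow_neg (by positivity)]
    have h2 : 2 * k / (2 * k + 1) = -(1 / (2 * k + 1)) + 1 := by field_simp; ring
    rw [h2, Real.rpow_add (by positivity), Real.rpow_one, ← h1]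
    field_simp
  refine ⟨⌊x⌋₊, Nat.one_le_floor_iff _ |>.2 hx1, ?_, ?_, ?_⟩
  · exact Nat.floor_le_of_le hxn
  · rw [← hxr]
    exact Real.rpow_le_rpow_of_nonpos hx0 (Nat.lt_floor_add_one x).le (by linarith)
  · rw [← hxℓ]
    have := Nat.floor_le hx0.le
    calc _ ≤ x * (4 * ℓ) := mul_le_mul this hlog10 (Real.log_nonneg (by nlinarith)) hx0.le
      _ = _ := by ring

theorem SobolevEllipsoid.congr_ae {k Q : ℝ} {f g : ℝ → ℝ} (hf : SobolevEllipsoid k Q f)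
    (h : f =ᵐ[volume.restrict (Set.Icc (-1 : ℝ) 1)] g) : SobolevEllipsoid k Q g := by
  obtain ⟨hm, β, hlim, hs⟩ := hf
  refine ⟨(memLp_congr_ae h).1 hm, β, ?_, hs⟩
  refine hlim.congr fun N => eLpNorm_congr_ae ?_
  filter_upwards [h] with t ht
  rw [ht]

variable {Ω : Type*} [MeasurableSpace Ω] {μ : Measure Ω} [IsProbabilityMeasure μ]
  {X : Ω → Matrix (Fin d) (Fin d) ℝ} {Y ε : Ω → ℝ} {B₀ : Matrix (Fin d) (Fin d) ℝ} {f₀ : ℝ → ℝ}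

/-- A neighbourhood of the truth with small excess risk and large prior mass. -/
theorem exists_neighbourhood {n : ℕ} {C : ℝ} (hC : 1 ≤ C) (hn : 3 ≤ n) (hdn : d ≤ n)
    (hlog : Real.log (C * n) ≤ n) {D₁ : ℝ} (hD₁ : 0 < D₁) {α : Fin d → ℝ} (hα0 : ∀ i, 0 < α i)
    (hα1 : ∀ i, α i ≤ 1) (hα : ∀ i, D₁ / d ≤ α i) (hX : Measurable X) (hB : B₀ ∈ indexSet d)
    (hf₀ : Measurable f₀) (hBX : ∀ᵐ ω ∂μ, ∀ i j, |X ω i j| ≤ 1) (hf₀C : ∀ t, |f₀ t| ≤ C)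
    {A : ℝ} (hA : 0 ≤ A) (hD : HasBoundedDensity μ (fun ω => pairing (X ω) B₀) A)
    {k : ℝ} (hk : 2 ≤ k) (hW : SobolevEllipsoid k (6 * C ^ 2 / Real.pi ^ 2) f₀) :
    ∃ T : Set (Matrix (Fin d) (Fin d) ℝ × C(ℝ, ℝ)), MeasurableSet T ∧
      (∀ θ ∈ T, excess μ X B₀ f₀ θ ≤ 3 * (A * (6 * C ^ 2 / Real.pi ^ 2
          * (Real.log (C * n) / n) ^ (2 * k / (2 * k + 1))))
        + 3 * (1 / n : ℝ) ^ 2 + 3 * (Real.pi * (C + 1) * (5 / n)) ^ 2) ∧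
      ENNReal.ofReal (Real.exp (-((5 * B₀.rank + 10 + Real.log (1 + 2 * Real.exp 2 / D₁)) * d
          * Real.log (16 * n) + 4 * (n * (Real.log (C * n) / n) ^ (2 * k / (2 * k + 1))))))
        ≤ prior n α (C + 1) T := by
  obtain ⟨hfm, β, hlim, hsum, hQ⟩ := hW
  have hn1 : 1 ≤ n := by omega
  have hn0 : (0 : ℝ) < n := by exact_mod_cast hn1
  have hnle : (1 : ℝ) ≤ n := by exact_mod_cast hn1
  obtain ⟨M, hM1, hMn, hMr, hMlog⟩ := exists_truncation hC (by linarith : 0 < k) hn hlog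
  have := isProbabilityMeasure_priorB hα0
  have := isProbabilityMeasure_priorF hn1 (by linarith : 0 < C + 1)
  set β₀ : Fin M → ℝ := fun i => β i with hβ₀
  have hw : wnorm β₀ ≤ C := sum_weighted_abs_le hk (by linarith) hsum hQ M
  set η : ℝ := d * (√(d * (1 / (n : ℝ) ^ 9)) + 2 * (d * (2 / ((n ^ 5 : ℕ) : ℝ)))) with hη
  refine ⟨{B | ∀ i j, |B i j - B₀ i j| ≤ η} ×ˢ
    ({f | ∀ x, |f x - synth M β₀ x| ≤ 1 / n} ∩ tameLinks (C + 1)), ?_, ?_, ?_⟩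
  · exact (measurableSet_entrywise_ball _ _).prod
      ((measurableSet_uniform_ball _ _).inter (measurableSet_tameLinks _))
  · rintro θ ⟨hθ1, hθ2, hθ3⟩
    have htr := lintegral_sq_sub_truncation_le (by linarith : 0 ≤ k) hfm hlim hsum hQ hM1
    have hsy : ∀ t, synth M β₀ t = ∑ j ∈ Finset.range M, β j * trig (j + 1) t := fun t => by
      rw [synth_apply, Finset.sum_range fun j => β j * trig (j + 1) t]
    simp_rw [← hsy] at htr
    have hq : 0 ≤ 6 * C ^ 2 / Real.pi ^ 2
        * (Real.log (C * n) / n) ^ (2 * k / (2 * k + 1)) := by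
      have : 0 ≤ Real.log (C * n) := Real.log_nonneg (by nlinarith)
      positivity
    refine (excess_le_of_near hX hf₀ hBX hA hD (K := C + 1) (fun t => (hf₀C t).trans (by linarith))
      (fun t => (abs_synth_le β₀ t).trans (by linarith)) hq
      (htr.trans (ENNReal.ofReal_le_ofReal (by gcongr))) hθ1 hθ2 hθ3).trans ?_
    have := entry_radius_le hn1 hdn
    gcongr
  · rw [prior, Measure.prod_prod]
    have h1 := le_priorB hα0 hα1 hB (m := n ^ 5) (Nat.one_le_pow _ _ (by omega))
      (h := 1 / (n : ℝ) ^ 9) (by positivity)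
      (by rw [div_le_one (by positivity)]; exact one_le_pow₀ hnle)
    -- The truncated coefficients have weighted norm at most C, so the radius C + 1 of the prior
    -- leaves room for a perturbation of size 1/n ≤ 1.
    have h2 := le_priorF (Λ := C + 1) hM1 hMn (β₀ := β₀) (t := 1 / n) (by positivity)
      (by
        have : (1 : ℝ) / n ≤ 1 := by rwa [div_le_one hn0]
        linarith) (by linarith)
    refine le_trans ?_ (mul_le_mul' h1 h2)
    rw [neg_add, Real.exp_add, ENNReal.ofReal_mul (Real.exp_pos _).le]
    refine mul_le_mul' (ENNReal.ofReal_le_ofReal ?_) (ENNReal.ofReal_le_ofReal ?_)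
    · exact exp_neg_le_matrix_mass hn1 hdn hD₁ hα _
    · calc _ ≤ Real.exp (-(M * Real.log (10 * (C + 1) * n))) := by
            apply Real.exp_le_exp.2; linarith
        _ = _ := by
            rw [← mul_neg, Real.exp_nat_mul, Real.exp_neg, Real.exp_log (by positivity)]
            congr 1
            field_simp

theorem excess_le_of_bounded {K : ℝ} (hf₀K : ∀ t, |f₀ t| ≤ K)
    {θ : Matrix (Fin d) (Fin d) ℝ × C(ℝ, ℝ)} (hθ : ∀ t, |θ.2 t| ≤ K) :
    excess μ X B₀ f₀ θ ≤ 4 * K ^ 2 := by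
  calc excess μ X B₀ f₀ θ ≤ ∫ _ω, 4 * K ^ 2 ∂μ := by
        refine integral_mono_of_nonneg (ae_of_all _ fun _ => sq_nonneg _) (integrable_const _)
          (ae_of_all _ fun ω => ?_)
        have h1 := abs_le.1 (hf₀K (pairing (X ω) B₀))
        have h2 := abs_le.1 (hθ (pairing (X ω) θ.1))
        show (f₀ (pairing (X ω) B₀) - θ.2 (pairing (X ω) θ.1)) ^ 2 ≤ 4 * K ^ 2
        nlinarith
    _ = _ := by simp

/-- The oracle inequality for link functions that are bounded on the whole real line. -/
theorem gibbs_rate_of_bounded {L C σ A D₁ : ℝ} (hL : 0 < L) (hC : 1 ≤ C) (hA : 0 < A)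
    (hD₁ : 0 < D₁) {n : ℕ} (hn : 1 ≤ n) {α : Fin d → ℝ} (hα : ∀ i, D₁ / d ≤ α i)
    (hα_sum : ∑ i, α i = 1) (hX : Measurable X) (hY : Measurable Y) (hε : Measurable ε)
    (hB : B₀ ∈ indexSet d) (hf₀ : Measurable f₀)
    (hmodel : ∀ᵐ ω ∂μ, Y ω = f₀ (pairing (X ω) B₀) + ε ω)
    (hmean : μ[ε | MeasurableSpace.comap X inferInstance] =ᵐ[μ] 0) (hN : SubexpNoise μ X ε σ L)
    (hBX : ∀ᵐ ω ∂μ, ∀ i j, |X ω i j| ≤ 1) (hf₀C : ∀ t, |f₀ t| ≤ C)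
    (hD : HasBoundedDensity μ (fun ω => pairing (X ω) B₀) A) {k : ℝ} (hk : 2 ≤ k)
    (hW : SobolevEllipsoid k (6 * C ^ 2 / Real.pi ^ 2) f₀) {δ : ℝ} (hδ₀ : 0 < δ) (hδ₁ : δ < 1)
    {w Ξ : ℝ} (hw : w = 64 * (C + 1) * max L (C + 1) + 2 * (8 * ((C + 1) ^ 2 + σ ^ 2)))
    (hΞ : 12 * A * (6 * C ^ 2 / Real.pi ^ 2) + 12 + 300 * (Real.pi * (C + 1)) ^ 2
      + 2 * w * (19 + Real.log (1 + 2 * Real.exp 2 / D₁)) + 16 * (C + 1) ^ 2 ≤ Ξ) :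
    ENNReal.ofReal (1 - δ) ≤ ∫⁻ D, gibbs α (C + 1) (invTemp n L C σ) D
      {θ | risk μ X Y θ.1 θ.2 - risk μ X Y B₀ f₀ ≤
        Ξ * ((Real.log (C * n) / n) ^ (2 * k / (2 * k + 1))
          + ((B₀.rank : ℝ) * d * Real.log (16 * n)
              + d * Real.log d * Real.log (2 * n * Real.exp 1)) / n
          + Real.log (2 / δ) / n)} ∂(sampleLaw μ n X Y) := by
  have hn1 : (1 : ℝ) ≤ n := by exact_mod_cast hn
  have hn0 : (0 : ℝ) < n := by linarith
  have hd : 0 < d := by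
    rcases Nat.eq_zero_or_pos d with rfl | h
    · simp at hα_sum
    · exact h
  have hd1 : (1 : ℝ) ≤ d := by exact_mod_cast hd
  have hα0 : ∀ i, 0 < α i := fun i => lt_of_lt_of_le (by positivity) (hα i)
  have hα1 : ∀ i, α i ≤ 1 := fun i => by
    rw [← hα_sum]; exact Finset.single_le_sum (fun j _ => (hα0 j).le) (Finset.mem_univ i)
  have hK : 0 < C + 1 := by linarith
  have hmaxL : L ≤ max L (C + 1) := le_max_left _ _
  have hmaxK : C + 1 ≤ max L (C + 1) := le_max_right _ _
  have hmax0 : 0 < max L (C + 1) := hL.trans_le hmaxL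
  have hprod0 : 0 < 64 * (C + 1) * max L (C + 1) := by positivity
  have hw0 : 0 < w := by rw [hw]; positivity
  have hlam : invTemp n L C σ = n / w := by rw [hw]; rfl
  have hlam0 : 0 < invTemp n L C σ := by rw [hlam]; positivity
  have hlamn : invTemp n L C σ / n = 1 / w := by rw [hlam]; field_simp
  have hf₀K : ∀ t, |f₀ t| ≤ C + 1 := fun t => (hf₀C t).trans (by linarith)
  have hsq := sq_nonneg (C + 1)
  have hsqσ := sq_nonneg σ
  have hbound := fun {T : Set (Matrix (Fin d) (Fin d) ℝ × C(ℝ, ℝ))} (hT : MeasurableSet T)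
      {E₀ κ : ℝ} (hTE : ∀ θ ∈ T, excess μ X B₀ f₀ θ ≤ E₀)
      (hκ : ENNReal.ofReal (Real.exp (-κ)) ≤ prior n α (C + 1) T) {b : ℝ} hb =>
    gibbs_excess_bound (b := b) hn hα0 hK hX hY hε hf₀ hmodel hmean hL hN hlam0
      (by
        rw [hlamn, mul_one_div, div_le_one hw0, hw]
        have : 64 * (C + 1) * L ≤ 64 * (C + 1) * max L (C + 1) := by gcongr
        linarith only [this, hsq, hsqσ])
      (by
        rw [hlamn, mul_one_div, div_le_one hw0, hw]
        have : 64 * (C + 1) * (C + 1) ≤ 64 * (C + 1) * max L (C + 1) := by gcongr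
        linarith only [this, hsq, hsqσ])
      (by rw [hlamn, mul_one_div, div_le_one hw0, hw]; linarith only [hprod0, hsq])
      hf₀K hT hTE hκ hδ₀ hb
  set R := (Real.log (C * n) / n) ^ (2 * k / (2 * k + 1)) with hR
  set G := (B₀.rank : ℝ) * d * Real.log (16 * n) / n with hG
  set P := Real.log (1 + 2 * Real.exp 2 / D₁) with hP
  set Q := 6 * C ^ 2 / Real.pi ^ 2 with hQ
  have hCn : 1 ≤ C * n := by nlinarith
  have hℓ0 : 0 ≤ Real.log (C * n) := Real.log_nonneg hCn
  have hR0 : 0 ≤ R := by positivity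
  have hrank : (1 : ℝ) ≤ B₀.rank := by exact_mod_cast one_le_rank_of_mem_indexSet hB
  have hlog16 := one_le_log_sixteen_mul hn
  have hGd : (d : ℝ) / n ≤ G := by
    rw [hG]
    gcongr
    calc (d : ℝ) = 1 * d * 1 := by ring
      _ ≤ _ := by gcongr
  have hGn : 1 / n ≤ G := le_trans (by gcongr) hGd
  have hG0 : 0 ≤ G := le_trans (by positivity) hGn
  have hH0 : 0 ≤ d * Real.log d * Real.log (2 * n * Real.exp 1) / n := by
    have h1 : 0 ≤ Real.log d := Real.log_nonneg hd1
    have h2 : 0 ≤ Real.log (2 * n * Real.exp 1) := Real.log_nonneg (by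
      have := Real.add_one_le_exp 1
      nlinarith)
    positivity
  have hLδ : 0 ≤ Real.log (2 / δ) / n := by
    have : 0 ≤ Real.log (2 / δ) := Real.log_nonneg (by rw [le_div_iff₀ hδ₀]; linarith)
    positivity
  have hP0 : 0 ≤ P := Real.log_nonneg (by
    have : 0 < 2 * Real.exp 2 / D₁ := by positivity
    linarith)
  have hQ0 : 0 ≤ Q := by positivity
  have hAQ : 0 ≤ A * Q := by positivity
  have hpiC := sq_nonneg (Real.pi * (C + 1))
  have hwP : 0 ≤ w * P := by positivity
  -- The deviation condition with λ = n/w, multiplied by 2w/n.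
  have hbR : ∀ E₀ κ : ℝ,
      4 * E₀ + 2 * w * (κ / n) + 4 * w * (Real.log (2 / δ) / n) ≤
        Ξ * (R + (B₀.rank * d * Real.log (16 * n)
          + d * Real.log d * Real.log (2 * n * Real.exp 1)) / n + Real.log (2 / δ) / n) →
      2 * invTemp n L C σ * E₀ + κ + 2 * Real.log (2 / δ) ≤ invTemp n L C σ / 2 *
        (Ξ * (R + (B₀.rank * d * Real.log (16 * n)
          + d * Real.log d * Real.log (2 * n * Real.exp 1)) / n + Real.log (2 / δ) / n)) := by
    intro E₀ κ h
    have h' := mul_le_mul_of_nonneg_left h (by positivity : 0 ≤ (n : ℝ) / w / 2)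
    rw [hlam]
    refine le_trans (le_of_eq ?_) h'
    field_simp
    ring
  have hΞ' : 12 * (A * Q) + 12 + 300 * (Real.pi * (C + 1)) ^ 2 + 38 * w + 2 * (w * P)
      + 16 * (C + 1) ^ 2 ≤ Ξ := by linarith only [hΞ]
  have hΞw : 4 * w ≤ Ξ := by linarith only [hΞ', hAQ, hpiC, hw0, hwP, hsq]
  have hΞ0 : 0 ≤ Ξ := by linarith only [hΞw, hw0]
  have hsplit : (B₀.rank * d * Real.log (16 * n)
      + d * Real.log d * Real.log (2 * n * Real.exp 1)) / n
      = G + d * Real.log d * Real.log (2 * n * Real.exp 1) / n := by rw [hG, add_div]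
  have hδterm : 4 * w * (Real.log (2 / δ) / n) ≤ Ξ * (Real.log (2 / δ) / n) :=
    mul_le_mul_of_nonneg_right hΞw hLδ
  -- Only the sign of this term matters: the prior-mass bounds fit into the terms R and G.
  have hHterm : 0 ≤ Ξ * (d * Real.log d * Real.log (2 * n * Real.exp 1) / n) :=
    mul_nonneg hΞ0 hH0
  -- If the rate is at least 1, the neighbourhood can be all bounded links, of prior mass 1, with
  -- excess at most 4(C+1)². Otherwise R + G < 1 forces d ≤ n, n ≥ 3 and log(Cn) ≤ n, which the
  -- construction of the neighbourhood requires.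
  by_cases htriv : 1 ≤ R + G
  · have hT : MeasurableSet {θ : Matrix (Fin d) (Fin d) ℝ × C(ℝ, ℝ) | θ.2 ∈ tameLinks (C + 1)} :=
      measurable_snd (measurableSet_tameLinks (C + 1))
    refine hbound hT (E₀ := 4 * (C + 1) ^ 2) (κ := 0)
      (fun θ hθ => excess_le_of_bounded hf₀K hθ.1) ?_ (hbR _ _ ?_)
    · have := isProbabilityMeasure_priorB hα0
      have := isProbabilityMeasure_priorF hn hK
      have hset : {θ : Matrix (Fin d) (Fin d) ℝ × C(ℝ, ℝ) | θ.2 ∈ tameLinks (C + 1)}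
          = Set.univ ×ˢ tameLinks (C + 1) := by ext; simp
      rw [hset, prior, Measure.prod_prod, measure_univ, one_mul,
        prob_compl_eq_zero_iff (measurableSet_tameLinks _) |>.1 (priorF_tameLinks n (C + 1))]
      simp
    · rw [hsplit]
      have h1 : 16 * (C + 1) ^ 2 ≤ Ξ := by linarith only [hΞ', hAQ, hpiC, hw0, hwP]
      have h2 : Ξ * 1 ≤ Ξ * (R + G) := mul_le_mul_of_nonneg_left htriv hΞ0
      rw [zero_div, mul_zero]
      linarith only [h1, h2, hδterm, hHterm]
  · rw [not_le] at htriv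
    have hdn : d ≤ n := by
      by_contra hcon
      have : (n : ℝ) < d := by exact_mod_cast not_le.1 hcon
      have : 1 < (d : ℝ) / n := by rwa [one_lt_div hn0]
      linarith only [this, hGd, hR0, htriv]
    have hn3 : 3 ≤ n := by
      by_contra hcon
      have hn2 : (n : ℝ) ≤ 2 := by exact_mod_cast (by omega : n ≤ 2)
      have hlog : 2 ≤ Real.log (16 * n) := by
        rw [Real.le_log_iff_exp_le (by positivity)]
        have h1 := Real.exp_one_lt_d9
        have h2 : Real.exp 2 = Real.exp 1 * Real.exp 1 := by rw [← Real.exp_add]; norm_num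
        have h3 : Real.exp 1 * Real.exp 1 ≤ 3 * 3 := by gcongr <;> linarith only [h1]
        linarith only [h2, h3, hn1]
      have : 1 ≤ G := by
        rw [hG, le_div_iff₀ hn0, one_mul]
        calc (n : ℝ) ≤ 1 * 1 * 2 := by linarith only [hn2]
          _ ≤ _ := by gcongr
      linarith only [this, hR0, htriv]
    have hlogn : Real.log (C * n) ≤ n := by
      by_contra hcon
      have h1 : 1 ≤ Real.log (C * n) / n := by
        rw [le_div_iff₀ hn0, one_mul]; exact (not_le.1 hcon).le
      have : 1 ≤ R := Real.one_le_rpow h1 (by positivity)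
      linarith only [this, hG0, htriv]
    obtain ⟨T, hT, hTE, hTκ⟩ := exists_neighbourhood hC hn3 hdn hlogn hD₁ hα0 hα1 hα hX hB hf₀
      hBX hf₀C hA.le hD hk hW
    refine hbound hT hTE hTκ (hbR _ _ ?_)
    rw [hsplit]
    have hn2 : (1 / n : ℝ) ^ 2 ≤ G := by
      refine le_trans ?_ hGn
      rw [sq]
      exact mul_le_of_le_one_left (by positivity) (by rwa [div_le_one hn0])
    have h5 : (Real.pi * (C + 1) * (5 / n)) ^ 2 ≤ 25 * (Real.pi * (C + 1)) ^ 2 * G := by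
      calc _ = 25 * (Real.pi * (C + 1)) ^ 2 * (1 / n : ℝ) ^ 2 := by ring
        _ ≤ _ := by gcongr
    have hκn : ((5 * B₀.rank + 10 + P) * d * Real.log (16 * n) + 4 * (n * R)) / n
        ≤ (15 + P) * G + 4 * R := by
      have h1 : ((5 * B₀.rank + 10 + P) * d * Real.log (16 * n) + 4 * (n * R)) / n
          = (5 * B₀.rank + 10 + P) * (d * Real.log (16 * n) / n) + 4 * R := by field_simp
      have h2 : (15 + P) * G = (15 + P) * B₀.rank * (d * Real.log (16 * n) / n) := by
        rw [hG]; ring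
      have h3 : 5 * (B₀.rank : ℝ) + 10 + P ≤ (15 + P) * B₀.rank := by
        have := mul_nonneg (by linarith : 0 ≤ 10 + P) (sub_nonneg.2 hrank)
        linarith only [this]
      rw [h1, h2]
      gcongr
    have hκw := mul_le_mul_of_nonneg_left hκn (by positivity : 0 ≤ 2 * w)
    have hΞR : (12 * (A * Q) + 8 * w) * R ≤ Ξ * R := by
      apply mul_le_mul_of_nonneg_right _ hR0
      linarith only [hΞ', hpiC, hw0, hwP, hsq]
    have hΞG : (12 + 300 * (Real.pi * (C + 1)) ^ 2 + 2 * w * (15 + P)) * G ≤ Ξ * G := by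
      apply mul_le_mul_of_nonneg_right _ hG0
      linarith only [hΞ', hAQ, hw0, hsq]
    linarith only [hn2, h5, hκw, hΞR, hΞG, hδterm, hHterm]

end Rates

/-! ### Reduction to a link function bounded on the whole line -/

theorem HasBoundedDensity.ae_mem {Ω : Type*} [MeasurableSpace Ω] {μ : Measure Ω} {Z : Ω → ℝ}
    {A : ℝ} (h : HasBoundedDensity μ Z A) (hZ : Measurable Z) :
    ∀ᵐ ω ∂μ, Z ω ∈ Set.Icc (-1 : ℝ) 1 := by
  obtain ⟨p, -, -, hmap⟩ := h
  refine ae_of_ae_map hZ.aemeasurable ?_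
  rw [hmap]
  exact (withDensity_absolutelyContinuous _ _).ae_le (ae_restrict_mem measurableSet_Icc)

end LowRankSIM

open LowRankSIM
theorem corollary1 (L C σ A D₁ : ℝ) (hL : 0 < L) (hC : 1 ≤ C) (hσ : 0 < σ) (hA : 0 < A)
    (hD₁ : 0 < D₁) :
    ∃ Ξ' : ℝ, 0 < Ξ' ∧
      ∀ (d n : ℕ) (_hn : 1 ≤ n)
        -- the Dirichlet parameters of the prior
        (α : Fin d → ℝ) (_hα : ∀ i, D₁ / d ≤ α i) (_hα_sum : ∑ i, α i = 1)
        -- the model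
        (Ω : Type*) [MeasurableSpace Ω] (μ : Measure Ω) [IsProbabilityMeasure μ]
        (X : Ω → Matrix (Fin d) (Fin d) ℝ) (Y ε : Ω → ℝ)
        (_hX : Measurable X) (_hY : Measurable Y) (_hε : Measurable ε)
        (Bstar : Matrix (Fin d) (Fin d) ℝ) (_hB : Bstar ∈ indexSet d)
        (fstar : ℝ → ℝ) (_hf : Measurable fstar)
        (_hmodel : ∀ᵐ ω ∂μ, Y ω = fstar (pairing (X ω) Bstar) + ε ω)
        (_hε_mean : μ[ε | MeasurableSpace.comap X inferInstance] =ᵐ[μ] 0)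
        -- the assumptions on the noise, the design and the link function
        (_hN : SubexpNoise μ X ε σ L)
        (_hBX : ∀ᵐ ω ∂μ, ∀ i j, |X ω i j| ≤ 1)
        (_hBf : ∀ t ∈ Set.Icc (-1 : ℝ) 1, |fstar t| ≤ C)
        (_hD : HasBoundedDensity μ (fun ω => pairing (X ω) Bstar) A)
        -- the regularity of the link function
        (k : ℝ) (_hk : 2 ≤ k) (_hW : SobolevEllipsoid k (6 * C ^ 2 / Real.pi ^ 2) fstar)
        -- the confidence level
        (δ : ℝ) (_hδ₀ : 0 < δ) (_hδ₁ : δ < 1),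
        ENNReal.ofReal (1 - δ) ≤
          ∫⁻ D, gibbs α (C + 1) (invTemp n L C σ) D
            {θ | risk μ X Y θ.1 θ.2 - risk μ X Y Bstar fstar ≤
              Ξ' * ((Real.log (C * n) / n) ^ (2 * k / (2 * k + 1))
                + ((Bstar.rank : ℝ) * d * Real.log (16 * n)
                    + d * Real.log d * Real.log (2 * n * Real.exp 1)) / n
                + Real.log (2 / δ) / n)}
          ∂(sampleLaw μ n X Y) := by
  set w : ℝ := 64 * (C + 1) * max L (C + 1) + 2 * (8 * ((C + 1) ^ 2 + σ ^ 2)) with hw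
  have hw0 : 0 < w := by positivity
  -- The first three terms are four times the coefficients of the three errors in the excess (300 =
  -- 4 · 3 · 5²); 19 = 15 + 4 collects the matrix and link complexities, and 16(C+1)² covers the
  -- case of a rate at least 1.
  refine ⟨12 * A * (6 * C ^ 2 / Real.pi ^ 2) + 12 + 300 * (Real.pi * (C + 1)) ^ 2
    + 2 * w * (19 + Real.log (1 + 2 * Real.exp 2 / D₁)) + 16 * (C + 1) ^ 2, ?_, ?_⟩
  · have hlog : 0 ≤ Real.log (1 + 2 * Real.exp 2 / D₁) := Real.log_nonneg (by
      have : 0 < 2 * Real.exp 2 / D₁ := by positivity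
      linarith)
    positivity
  intro d n hn α hα hα_sum Ω _ μ _ X Y ε hX hY hε Bstar hB fstar hf hmodel hmean hN hBX hBf hD
    k hk hW δ hδ₀ hδ₁
  -- The link is bounded by C only on [-1, 1]. Cutting it off outside changes nothing almost surely,
  -- because ⟨X, B⋆⟩ lies in [-1, 1] almost surely and the ellipsoid sees only this interval.
  set f₀ : ℝ → ℝ := (Set.Icc (-1 : ℝ) 1).indicator fstar with hf₀_def
  have hf₀ : Measurable f₀ := hf.indicator measurableSet_Icc
  have hmem : ∀ᵐ ω ∂μ, pairing (X ω) Bstar ∈ Set.Icc (-1 : ℝ) 1 :=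
    hD.ae_mem (continuous_pairing.measurable.comp (hX.prodMk measurable_const))
  have hmodel₀ : ∀ᵐ ω ∂μ, Y ω = f₀ (pairing (X ω) Bstar) + ε ω := by
    filter_upwards [hmodel, hmem] with ω h1 h2
    rw [hf₀_def, Set.indicator_of_mem h2, h1]
  have hf₀C : ∀ t, |f₀ t| ≤ C := by
    intro t
    by_cases ht : t ∈ Set.Icc (-1 : ℝ) 1
    · rw [hf₀_def, Set.indicator_of_mem ht]; exact hBf t ht
    · rw [hf₀_def, Set.indicator_of_notMem ht, abs_zero]; linarith
  have hW₀ : SobolevEllipsoid k (6 * C ^ 2 / Real.pi ^ 2) f₀ := by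
    refine hW.congr_ae ?_
    filter_upwards [ae_restrict_mem measurableSet_Icc] with t ht
    rw [hf₀_def, Set.indicator_of_mem ht]
  have hrisk : risk μ X Y Bstar fstar = risk μ X Y Bstar f₀ := by
    refine integral_congr_ae ?_
    filter_upwards [hmem] with ω h2
    rw [hf₀_def, Set.indicator_of_mem h2]
  rw [hrisk]
  exact gibbs_rate_of_bounded hL hC hA hD₁ hn hα hα_sum hX hY hε hB hf₀ hmodel₀ hmean hN hBX hf₀C
    hD hk hW₀ hδ₀ hδ₁ hw le_rfl
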